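/- Let $(\mathcal C,\mathbb E,\mathfrak s)$ be an extriangulated category in the sense of Nakaoka and Palu. Let $\mathbb E^1=\mathbb E$ and $\mathbb E^{i+1}(Z,A)=\int^{W}\mathbb E^{i}(W,A)\otimes\mathbb E(Z,W)$ $(i\ge 1)$ be its higher extension bifunctors. Classes of objects of $\mathcal C$ are written $\mathcal X,\mathcal T,\dots$, and $A\to B\to Z\dashrightarrow$ denotes an $\mathbb E$-triangle. We use the following notions. - $\operatorname{smd}(\mathcal X)$ is the class of direct summands of objects of $\mathcal X$, i.e. of the objects $N$ for which there are $M\in\mathcal X$ and morphisms $i:N\to M$, $p:M\to N$ with $pi=1_N$. $\mathcal X$ is closed under extensions if $A,Z\in\mathcal X$ implies $B\in\mathcal X$ for every $\mathbb E$-triangle $A\to B\to Z\dashrightarrow$. - $\mathcal T^{\perp}$ is the class of all $A$ with $\mathbb E^i(Z,A)=0$ for all $Z\in\mathcal T$ and $i\ge 1$. - $\operatorname{pd}_{\mathcal X}(\mathcal T)=\sup_{Z\in\mathcal T}\operatorname{pd}_{\mathcal X}(Z)$, where $\operatorname{pd}_{\mathcal X}(Z)\in\mathbb N\cup\{\infty\}$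 is the least $m$ with $\mathbb E^k(Z,A)=0$ for all $k>m$ and $A\in\mathcal X$. - $\omega$ is a relative generator in $\mathcal X$ if $\omega\subseteq\mathcal X$ and each $Z\in\mathcal X$ has an $\mathbb E$-triangle $X'\to W\to Z\dashrightarrow$ with $W\in\omega$, $X'\in\mathcal X$. Dually, $\alpha$ is a relative cogenerator in $\mathcal X$ if $\alpha\subseteq\mathcal X$ and each $Z\in\mathcal X$ has an $\mathbb E$-triangle $Z\to W\to X'\dashrightarrow$ with $W\in\alpha$, $X'\in\mathcal X$. - $\mathcal T^{\vee}_{\mathcal X}$ is the class of all $M$ for which there are $m\ge 0$ and $\mathbb E$-triangles $N_{j-1}\to T_j\to N_j\dashrightarrow$ $(0\le j\le m-1)$ with $N_{-1}=M$, $T_j\in\mathcal T$, $N_j\in\mathcal X$ for $0\le j\le m-1$, and $N_{m-1}\cong T_m$ for some $T_m\in\mathcal T\cap\mathcal X$. - A $\mathcal T$-precover of $Z$ is a morphism $f:T'\to Z$ with $T'\in\mathcal T$ through which every morphism $T''\to Z$ with $T''\in\mathcal T$ factors. - For $n\ge 1$, $\operatorname{Fac}^{\mathcal X}_n(\mathcal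 T)$ is the class of all $B$ for which there are $\mathbb E$-triangles $K_j\to T_j\to K_{j-1}\dashrightarrow$ $(1\le j\le n)$ with $K_0=B$, $T_j\in\mathcal T\cap\mathcal X$ and $K_j\in\mathcal X$ for $1\le j\le n$. - For $n\ge 1$, a class $\mathcal Y\subseteq\mathcal X$ is closed by $n$-quotients in $\mathcal X$ if $B\in\mathcal Y$ whenever $B\in\mathcal X$ and there are $\mathbb E$-triangles $K_j\to Y_j\to K_{j-1}\dashrightarrow$ $(1\le j\le n)$ with $K_0=B$, $Y_j\in\mathcal Y$ and $K_j\in\mathcal X$ for $1\le j\le n$. - $\mathcal T$ is $n$-$\mathcal X$-tilting if: (T0) $\mathcal T=\operatorname{smd}(\mathcal T)$; (T1) $\operatorname{pd}_{\mathcal X}(\mathcal T)\le n$; (T2) $\mathcal T\cap\mathcal X\subseteq\mathcal T^{\perp}$; (T3) some class $\omega\subseteq\mathcal T^{\vee}_{\mathcal X}$ is a relative generator in $\mathcal X$; (T4) some class $\alpha\subseteq\mathcal X^{\perp}\cap\mathcal T^{\perp}$ is a relative cogenerator in $\mathcal X$; (T5) every $Z\in\mathcal X\cap\mathcal T^{\perp}$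 has a $\mathcal T$-precover $T'\to Z$ with $T'\in\mathcal X$. **Theorem.** Let $n\ge 1$, let $\mathcal X=\operatorname{smd}(\mathcal X)$ be closed under extensions, and let $\mathcal T=\operatorname{smd}(\mathcal T)$ satisfy (T4) and (T5). Then the following conditions are equivalent: 1. $\mathcal T$ is $n$-$\mathcal X$-tilting; 2. $\operatorname{Fac}^{\mathcal X}_n(\mathcal T)\cap\mathcal X=\mathcal T^{\perp}\cap\mathcal X$; 3. $\mathcal T^{\perp}\cap\mathcal X=\operatorname{Fac}^{\mathcal X}_k(\mathcal T)\cap\mathcal X$ for all $k\ge n$; 4. $\mathcal T^{\perp}\cap\mathcal X$ is closed by $n$-quotients in $\mathcal X$, and $\mathcal T\cap\mathcal X\subseteq\mathcal T^{\perp}\cap\mathcal X\subseteq\operatorname{Fac}^{\mathcal X}_1(\mathcal T)$. -/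

import Mathlib

open CategoryTheory CategoryTheory.Limits Opposite

universe w v u

namespace Extri

section Bifunctor

variable {C : Type u} [Category.{v} C] (E : Cᵒᵖ ⥤ C ⥤ AddCommGrpCat.{w})

/-- The group `𝔼(Z, A)` of extensions of `Z` by `A`. -/
abbrev Extn (Z A : C) : Type w := (E.obj (op Z)).obj A

/-- The pull-back `c^* : 𝔼(Z, A) → 𝔼(Z', A)` along `c : Z' ⟶ Z`. -/
def pull {Z' Z : C} (c : Z' ⟶ Z) (A : C) : Extn E Z A →+ Extn E Z' A :=
  ((E.map c.op).app A).hom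

/-- The push-forward `a_* : 𝔼(Z, A) → 𝔼(Z, A')` along `a : A ⟶ A'`. -/
def push {A A' : C} (a : A ⟶ A') (Z : C) : Extn E Z A →+ Extn E Z A' :=
  ((E.obj (op Z)).map a).hom

/-! ### Higher extension groups

For a contravariant functor `F`, the functor `F ⋄ 𝔼` is the coend
`Z ↦ ∫^X F(X) ⊗ 𝔼(Z, X)`, given by generators `x ⊗ δ` and relations. -/

variable (F : Cᵒᵖ ⥤ AddCommGrpCat.{max u w})

/-- Generators of `(F ⋄ 𝔼)(Z)`: pairs `(x, δ)` with `x ∈ F(X)` and `δ ∈ 𝔼(Z, X)` for some `X`. -/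
abbrev CoendGen (Z : C) : Type (max u w) := Σ X : C, F.obj (op X) × Extn E Z X

/-- Relations of `(F ⋄ 𝔼)(Z)`: biadditivity of `x ⊗ δ`, and `f^* x ⊗ δ = x ⊗ f_* δ`. -/
inductive CoendRel (Z : C) : FreeAbelianGroup (CoendGen E F Z) → Prop
  | add_left (X : C) (x x' : F.obj (op X)) (δ : Extn E Z X) :
      CoendRel Z (FreeAbelianGroup.of ⟨X, x + x', δ⟩
        - FreeAbelianGroup.of ⟨X, x, δ⟩ - FreeAbelianGroup.of ⟨X, x', δ⟩)
  | add_right (X : C) (x : F.obj (op X)) (δ δ' : Extn E Z X) :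
      CoendRel Z (FreeAbelianGroup.of ⟨X, x, δ + δ'⟩
        - FreeAbelianGroup.of ⟨X, x, δ⟩ - FreeAbelianGroup.of ⟨X, x, δ'⟩)
  | balanced {X Y : C} (f : X ⟶ Y) (x : F.obj (op Y)) (δ : Extn E Z X) :
      CoendRel Z (FreeAbelianGroup.of ⟨X, (F.map f.op).hom x, δ⟩
        - FreeAbelianGroup.of ⟨Y, x, push E f Z δ⟩)

/-- The subgroup generated by the relations. -/
def coendRelSubgroup (Z : C) : AddSubgroup (FreeAbelianGroup (CoendGen E F Z)) :=
  AddSubgroup.closure {r | CoendRel E F Z r}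

/-- The group `(F ⋄ 𝔼)(Z)`. -/
abbrev CoendObj (Z : C) : Type (max u w) :=
  FreeAbelianGroup (CoendGen E F Z) ⧸ coendRelSubgroup E F Z

/-- The map on generators `x ⊗ δ ↦ x ⊗ c^* δ`. -/
def coendGenMap {Z' Z : C} (c : Z' ⟶ Z) :
    FreeAbelianGroup (CoendGen E F Z) →+ FreeAbelianGroup (CoendGen E F Z') :=
  FreeAbelianGroup.map fun g => ⟨g.1, g.2.1, pull E c g.1 g.2.2⟩

theorem pull_push {Z' Z A A' : C} (c : Z' ⟶ Z) (a : A ⟶ A') (δ : Extn E Z A) :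
    pull E c A' (push E a Z δ) = push E a Z' (pull E c A δ) :=
  (ConcreteCategory.congr_hom ((E.map c.op).naturality a) δ)

theorem pull_id (Z A : C) (δ : Extn E Z A) : pull E (𝟙 Z) A δ = δ := by
  simp [pull]

theorem pull_comp {Z'' Z' Z : C} (c' : Z'' ⟶ Z') (c : Z' ⟶ Z) (A : C) (δ : Extn E Z A) :
    pull E (c' ≫ c) A δ = pull E c' A (pull E c A δ) := by
  simp [pull]

theorem coendGenMap_of {Z' Z : C} (c : Z' ⟶ Z) (X : C) (x : F.obj (op X)) (δ : Extn E Z X) :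
    coendGenMap E F c (FreeAbelianGroup.of ⟨X, x, δ⟩)
      = FreeAbelianGroup.of ⟨X, x, pull E c X δ⟩ :=
  FreeAbelianGroup.map_of_apply _

theorem coendRelSubgroup_le {Z' Z : C} (c : Z' ⟶ Z) :
    coendRelSubgroup E F Z ≤ (coendRelSubgroup E F Z').comap (coendGenMap E F c) := by
  rw [coendRelSubgroup, AddSubgroup.closure_le]
  intro r hr
  refine AddSubgroup.subset_closure (?_ : CoendRel E F Z' (coendGenMap E F c r))
  cases hr with
  | add_left X x x' δ =>
    simp only [map_sub, coendGenMap_of]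
    exact CoendRel.add_left X x x' _
  | add_right X x δ δ' =>
    simp only [map_sub, coendGenMap_of, map_add]
    exact CoendRel.add_right X x _ _
  | balanced f x δ =>
    simp only [map_sub, coendGenMap_of, pull_push]
    exact CoendRel.balanced f x _

/-- The map `c^* : (F ⋄ 𝔼)(Z) → (F ⋄ 𝔼)(Z')`. -/
def coendMap {Z' Z : C} (c : Z' ⟶ Z) : CoendObj E F Z →+ CoendObj E F Z' :=
  QuotientAddGroup.map _ _ (coendGenMap E F c) (coendRelSubgroup_le E F c)

theorem coendMap_id (Z : C) : coendMap E F (𝟙 Z) = AddMonoidHom.id _ := by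
  refine QuotientAddGroup.addMonoidHom_ext _ (FreeAbelianGroup.lift_ext _ _ ?_)
  rintro ⟨X, x, δ⟩
  change QuotientAddGroup.mk (coendGenMap E F (𝟙 Z) (FreeAbelianGroup.of ⟨X, x, δ⟩)) = _
  rw [coendGenMap_of, pull_id]
  rfl

theorem coendMap_comp {Z'' Z' Z : C} (c' : Z'' ⟶ Z') (c : Z' ⟶ Z) :
    coendMap E F (c' ≫ c) = (coendMap E F c').comp (coendMap E F c) := by
  refine QuotientAddGroup.addMonoidHom_ext _ (FreeAbelianGroup.lift_ext _ _ ?_)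
  rintro ⟨X, x, δ⟩
  change QuotientAddGroup.mk (coendGenMap E F (c' ≫ c) (FreeAbelianGroup.of ⟨X, x, δ⟩)) =
    QuotientAddGroup.mk
      (coendGenMap E F c' (coendGenMap E F c (FreeAbelianGroup.of ⟨X, x, δ⟩)))
  rw [coendGenMap_of, coendGenMap_of, coendGenMap_of, pull_comp]

/-- The functor `F ⋄ 𝔼 : Z ↦ ∫^X F(X) ⊗ 𝔼(Z, X)`. -/
def coendFunctor : Cᵒᵖ ⥤ AddCommGrpCat.{max u w} where
  obj Z := AddCommGrpCat.of (CoendObj E F Z.unop)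
  map c := AddCommGrpCat.ofHom (coendMap E F c.unop)
  map_id Z := by
    rw [unop_id, coendMap_id]; rfl
  map_comp c c' := by
    rw [unop_comp, coendMap_comp]; rfl

/-- The higher extension functors in their first argument, with a shift of the index:
`posExt E A i` is `𝔼^{i+1}(-, A)`, where `𝔼^1 = 𝔼` and `𝔼^{m+1} = 𝔼^m ⋄ 𝔼`. -/
def posExt (A : C) : ℕ → (Cᵒᵖ ⥤ AddCommGrpCat.{max u w})
  | 0 => E.flip.obj A ⋙ AddCommGrpCat.uliftFunctor.{u, w}
  | i + 1 => coendFunctor E (posExt A i)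

/-- `𝔼^{i+1}(Z, A) = 0`. -/
def SuccExtVanishes (i : ℕ) (Z A : C) : Prop :=
  Subsingleton ((posExt E A i).obj (op Z))

/-- The right orthogonal class `𝒯^⊥`: the objects `A` with `𝔼^i(Z, A) = 0` for all `Z` in `𝒯`
and all `i ≥ 1`. -/
def rightPerp (T : ObjectProperty C) : ObjectProperty C :=
  fun A => ∀ (i : ℕ) (Z : C), T Z → SuccExtVanishes E i Z A

/-- The relative projective dimension `pd_𝒳(Z)`, the least `n` such that `𝔼^k(Z, A) = 0` for all
`k > n` and all `A` in `𝒳`, and `∞` if there is no such `n`. -/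
noncomputable def pdObj (X : ObjectProperty C) (Z : C) : ℕ∞ :=
  ⨅ (n : ℕ) (_ : ∀ i : ℕ, n < i + 1 → ∀ A : C, X A → SuccExtVanishes E i Z A), (n : ℕ∞)

/-- The relative projective dimension `pd_𝒳(𝒯) = sup {pd_𝒳(Z) | Z ∈ 𝒯}` of a class. -/
noncomputable def pd (X T : ObjectProperty C) : ℕ∞ :=
  ⨆ (Z : C) (_ : T Z), pdObj E X Z

end Bifunctor

/-- `f : T' ⟶ Z` is a `𝒯`-precover of `Z`. -/
def IsPrecover {C : Type u} [Category.{v} C] (T : ObjectProperty C) {T' Z : C} (f : T' ⟶ Z) :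
    Prop :=
  T T' ∧ ∀ T'' : C, T T'' → ∀ g : T'' ⟶ Z, ∃ h : T'' ⟶ T', h ≫ f = g

section Extriangulation

variable {C : Type u} [Category.{v} C] [Preadditive C] [HasZeroObject C] [HasBinaryBiproducts C]

/-- The direct sum `δ ⊕ δ' ∈ 𝔼(Z ⊕ Z', A ⊕ A')`, the element with components `(δ, 0, 0, δ')`. -/
noncomputable def extSum (E : Cᵒᵖ ⥤ C ⥤ AddCommGrpCat.{w}) {Z A Z' A' : C}
    (δ : Extn E Z A) (δ' : Extn E Z' A') : Extn E (Z ⊞ Z') (A ⊞ A') :=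
  push E biprod.inl _ (pull E biprod.fst A δ) + push E biprod.inr _ (pull E biprod.snd A' δ')

/-- The structure of an extriangulated category with extension bifunctor `E` on the additive
category `C`. The proposition `Real x y δ` says that the sequence `A ⟶ B ⟶ Z` given by `x`, `y`
belongs to the class `𝔰(δ)`, that is, that `A ⟶ B ⟶ Z ⇢ δ` is an `𝔼`-triangle. -/
structure Extriangulation (E : Cᵒᵖ ⥤ C ⥤ AddCommGrpCat.{w}) where
  /-- (ET1) `𝔼` is additive in the second argument. -/
  additive_right : ∀ Z : Cᵒᵖ, (E.obj Z).Additive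
  /-- (ET1) `𝔼` is additive in the first argument. -/
  additive_left : ∀ A : C, (E.flip.obj A).Additive
  /-- The `𝔼`-triangles. -/
  Real : ∀ {A B Z : C}, (A ⟶ B) → (B ⟶ Z) → Extn E Z A → Prop
  /-- `𝔰(δ)` is not empty. -/
  exists_real : ∀ {A Z : C} (δ : Extn E Z A), ∃ (B : C) (x : A ⟶ B) (y : B ⟶ Z), Real x y δ
  /-- `𝔰(δ)` is closed under equivalence of sequences. -/
  real_of_iso : ∀ {A B B' Z : C} {x : A ⟶ B} {y : B ⟶ Z} {δ : Extn E Z A} (e : B ≅ B'),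
    Real x y δ → Real (x ≫ e.hom) (e.inv ≫ y) δ
  /-- Any two sequences in `𝔰(δ)` are equivalent. -/
  real_unique : ∀ {A B B' Z : C} {x : A ⟶ B} {y : B ⟶ Z} {x' : A ⟶ B'} {y' : B' ⟶ Z}
    {δ : Extn E Z A}, Real x y δ → Real x' y' δ →
    ∃ e : B ≅ B', x ≫ e.hom = x' ∧ e.hom ≫ y' = y
  /-- (ET2) `𝔰` is a realization: morphisms of extensions lift to morphisms of sequences. -/
  real_lift : ∀ {A B Z A' B' Z' : C} {x : A ⟶ B} {y : B ⟶ Z} {δ : Extn E Z A}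
    {x' : A' ⟶ B'} {y' : B' ⟶ Z'} {δ' : Extn E Z' A'}, Real x y δ → Real x' y' δ' →
    ∀ (a : A ⟶ A') (c : Z ⟶ Z'), push E a Z δ = pull E c A' δ' →
    ∃ b : B ⟶ B', x ≫ b = a ≫ x' ∧ y ≫ c = b ≫ y'
  /-- (ET2) `𝔰(0)` is the split sequence. -/
  real_zero : ∀ A Z : C,
    Real (biprod.inl : A ⟶ A ⊞ Z) (biprod.snd : A ⊞ Z ⟶ Z) (0 : Extn E Z A)
  /-- (ET2) `𝔰(δ ⊕ δ') = 𝔰(δ) ⊕ 𝔰(δ')`. -/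
  real_sum : ∀ {A B Z A' B' Z' : C} {x : A ⟶ B} {y : B ⟶ Z} {δ : Extn E Z A}
    {x' : A' ⟶ B'} {y' : B' ⟶ Z'} {δ' : Extn E Z' A'}, Real x y δ → Real x' y' δ' →
    Real (biprod.map x x') (biprod.map y y') (extSum E δ δ')
  /-- (ET3). -/
  et3 : ∀ {A B Z A' B' Z' : C} {x : A ⟶ B} {y : B ⟶ Z} {δ : Extn E Z A}
    {x' : A' ⟶ B'} {y' : B' ⟶ Z'} {δ' : Extn E Z' A'}, Real x y δ → Real x' y' δ' →
    ∀ (a : A ⟶ A') (b : B ⟶ B'), x ≫ b = a ≫ x' →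
    ∃ c : Z ⟶ Z', y ≫ c = b ≫ y' ∧ push E a Z δ = pull E c A' δ'
  /-- The dual of (ET3). -/
  et3_op : ∀ {A B Z A' B' Z' : C} {x : A ⟶ B} {y : B ⟶ Z} {δ : Extn E Z A}
    {x' : A' ⟶ B'} {y' : B' ⟶ Z'} {δ' : Extn E Z' A'}, Real x y δ → Real x' y' δ' →
    ∀ (b : B ⟶ B') (c : Z ⟶ Z'), y ≫ c = b ≫ y' →
    ∃ a : A ⟶ A', x ≫ b = a ≫ x' ∧ push E a Z δ = pull E c A' δ'
  /-- (ET4). -/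
  et4 : ∀ {A B D G H : C} {f : A ⟶ B} {f' : B ⟶ D} {δ : Extn E D A}
    {g : B ⟶ G} {g' : G ⟶ H} {δ' : Extn E H B}, Real f f' δ → Real g g' δ' →
    ∃ (K : C) (d : D ⟶ K) (e : K ⟶ H) (h' : G ⟶ K) (δ'' : Extn E K A),
      Real (f ≫ g) h' δ'' ∧ f' ≫ d = g ≫ h' ∧ h' ≫ e = g' ∧
      Real d e (push E f' H δ') ∧ pull E d A δ'' = δ ∧ push E f K δ'' = pull E e B δ'
  /-- The dual of (ET4). -/
  et4_op : ∀ {D A B H G : C} {f' : D ⟶ A} {f : A ⟶ B} {δ : Extn E B D}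
    {g' : H ⟶ B} {g : B ⟶ G} {δ' : Extn E G H}, Real f' f δ → Real g' g δ' →
    ∃ (K : C) (d : D ⟶ K) (e : K ⟶ H) (h' : K ⟶ A) (δ'' : Extn E G K),
      Real h' (f ≫ g) δ'' ∧ d ≫ h' = f' ∧ h' ≫ f = e ≫ g' ∧
      Real d e (pull E g' D δ) ∧ push E e G δ'' = δ' ∧ push E d B δ = pull E g K δ''

namespace Extriangulation

variable {E : Cᵒᵖ ⥤ C ⥤ AddCommGrpCat.{w}} (s : Extriangulation E)

/-- There is an `𝔼`-triangle `A ⟶ B ⟶ Z ⇢`. -/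
def Tri (A B Z : C) : Prop :=
  ∃ (x : A ⟶ B) (y : B ⟶ Z) (δ : Extn E Z A), s.Real x y δ

/-- `𝒳` is closed under extensions. -/
def ClosedUnderExtensions (X : ObjectProperty C) : Prop :=
  ∀ A B Z : C, s.Tri A B Z → X A → X Z → X B

/-- `ω` is a relative generator in `𝒳`. -/
def IsRelGenerator (X ω : ObjectProperty C) : Prop :=
  ω ≤ X ∧ ∀ Z : C, X Z → ∃ X' W : C, s.Tri X' W Z ∧ ω W ∧ X X'

/-- `α` is a relative cogenerator in `𝒳`. -/
def IsRelCogenerator (X α : ObjectProperty C) : Prop :=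
  α ≤ X ∧ ∀ Z : C, X Z → ∃ W X' : C, s.Tri Z W X' ∧ α W ∧ X X'

/-- The class `𝒴^∨_𝒳` of the objects `M` with a finite `𝒴_𝒳`-coresolution
`M ⟶ Y₀ ⟶ ⋯ ⟶ Yₙ`, glued from `𝔼`-triangles `M ⟶ Y₀ ⟶ N₀`, `N₀ ⟶ Y₁ ⟶ N₁`, …,
`Nₙ₋₂ ⟶ Yₙ₋₁ ⟶ Nₙ₋₁ ≅ Yₙ` with `Yₖ ∈ 𝒴`, `Nₖ ∈ 𝒳` for `k < n` and `Yₙ ∈ 𝒳 ∩ 𝒴`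
(for `n = 0` this means `M ≅ Y₀ ∈ 𝒳 ∩ 𝒴`). -/
inductive FinCores (X Y : ObjectProperty C) : C → Prop
  | base {M Y₀ : C} (i : M ≅ Y₀) (hX : X Y₀) (hY : Y Y₀) : FinCores X Y M
  | step {M Y₀ N₀ : C} (h : s.Tri M Y₀ N₀) (hY : Y Y₀) (hX : X N₀)
      (hN : FinCores X Y N₀) : FinCores X Y M

/-- `LeftRes X Y n B` : there is a complex `Kₙ ⟶ Yₙ ⟶ ⋯ ⟶ Y₁ ⟶ B` glued from `𝔼`-triangles
`K₁ ⟶ Y₁ ⟶ B`, `K₂ ⟶ Y₂ ⟶ K₁`, …, `Kₙ ⟶ Yₙ ⟶ Kₙ₋₁` with all `Yᵢ ∈ 𝒴` and all `Kᵢ ∈ 𝒳`. -/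
def LeftRes (X Y : ObjectProperty C) : ℕ → ObjectProperty C
  | 0, _ => True
  | n + 1, B => ∃ K₁ Y₁ : C, s.Tri K₁ Y₁ B ∧ Y Y₁ ∧ X K₁ ∧ LeftRes X Y n K₁

/-- The class `Fac^𝒳_n(𝒯)` (for `n ≥ 1`). -/
def Fac (X T : ObjectProperty C) (n : ℕ) : ObjectProperty C :=
  s.LeftRes X (T ⊓ X) n

/-- `𝒴 ⊆ 𝒳` is closed by `n`-quotients in `𝒳` (for `n ≥ 1`). -/
def ClosedByQuotients (n : ℕ) (X Y : ObjectProperty C) : Prop :=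
  Y ≤ X ∧ ∀ B : C, X B → s.LeftRes X Y n B → Y B

/-- (T3): some class `ω ⊆ 𝒯^∨_𝒳` is a relative generator in `𝒳`. -/
def T3 (X T : ObjectProperty C) : Prop :=
  ∃ ω : ObjectProperty C, ω ≤ s.FinCores X T ∧ s.IsRelGenerator X ω

/-- (T4): some class `α ⊆ 𝒳^⊥ ∩ 𝒯^⊥` is a relative cogenerator in `𝒳`. -/
def T4 (X T : ObjectProperty C) : Prop :=
  ∃ α : ObjectProperty C, α ≤ rightPerp E X ⊓ rightPerp E T ∧ s.IsRelCogenerator X α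

end Extriangulation

/-- (T5): every `Z ∈ 𝒳 ∩ 𝒯^⊥` has a `𝒯`-precover `T' ⟶ Z` with `T' ∈ 𝒳`. -/
def T5 (E : Cᵒᵖ ⥤ C ⥤ AddCommGrpCat.{w}) (X T : ObjectProperty C) : Prop :=
  ∀ Z : C, X Z → rightPerp E T Z → ∃ (T' : C) (f : T' ⟶ Z), IsPrecover T f ∧ X T'

/-- `𝒯` is an `n`-`𝒳`-tilting class. -/
structure Extriangulation.IsTilting {E : Cᵒᵖ ⥤ C ⥤ AddCommGrpCat.{w}} (s : Extriangulation E)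
    (n : ℕ) (X T : ObjectProperty C) : Prop where
  /-- (T0): `𝒯 = smd(𝒯)`. -/
  t0 : T = T.retractClosure
  /-- (T1): `pd_𝒳(𝒯) ≤ n`. -/
  t1 : pd E X T ≤ n
  /-- (T2): `𝒯 ∩ 𝒳 ⊆ 𝒯^⊥`. -/
  t2 : T ⊓ X ≤ rightPerp E T
  t3 : s.T3 X T
  t4 : s.T4 X T
  t5 : T5 E X T

end Extriangulation

end Extri

/-!
For effaceable `F` (each element dies along a deflation), `x ⊗ δ = 0` in `F ⋄ 𝔼` exactly when `δ`
lifts along a morphism that kills `x`. All `𝔼ⁱ(-, A)` are effaceable, so `- ⋄ 𝔼` carries the exact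
sequences of low degree to long exact sequences of the higher extensions.

Adding a deflation `T₀ ⟶ M` from `𝒯 ∩ 𝒳` to a `𝒯`-precover of `M ∈ 𝒯^⊥ ∩ 𝒳` gives a deflation
through which all morphisms from `𝒯` still factor. Its cocone lies in `𝒯^⊥`, so `𝒯 ∩ 𝒳` is a
relative generator in `𝒯^⊥ ∩ 𝒳`, and resolutions by objects of `𝒯^⊥ ∩ 𝒳` can be replaced by
resolutions by objects of `𝒯 ∩ 𝒳`. The deflations `T₀ ⟶ M` come from (T3) if `𝒯` is tilting, and
`Fac^𝒳_n(𝒯) ∩ 𝒳 ⊆ 𝒯^⊥` is then dimension shifting with (T1). Conversely, closure under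
`n`-quotients puts the `n`-th cosyzygies of the objects of `𝒳` along the class `α` of (T4) into
`𝒯^⊥`; dimension shifting gives (T1), and pulling back deflations from `𝒯 ∩ 𝒳` along the
coresolution gives (T3).
-/

namespace Extri

/-! ### Long exact sequences of low degree -/

section Bifunctor

variable {C : Type u} [Category.{v} C] (E : Cᵒᵖ ⥤ C ⥤ AddCommGrpCat.{w})

theorem push_id (Z A : C) (δ : Extn E Z A) : push E (𝟙 A) Z δ = δ := by
  simp [push]

theorem push_comp {A A' A'' : C} (a : A ⟶ A') (a' : A' ⟶ A'') (Z : C) (δ : Extn E Z A) :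
    push E (a ≫ a') Z δ = push E a' Z (push E a Z δ) := by
  simp [push]

end Bifunctor

section Triangles

variable {C : Type u} [Category.{v} C] [Preadditive C] [HasBinaryBiproducts C]
  {E : Cᵒᵖ ⥤ C ⥤ AddCommGrpCat.{w}}

/-- The extension in `𝔼(Z, V ⊞ W)` with components `ε ∈ 𝔼(Z, V)` and `ε' ∈ 𝔼(Z, W)`. -/
noncomputable def extLift {Z V W : C} (ε : Extn E Z V) (ε' : Extn E Z W) : Extn E Z (V ⊞ W) :=
  push E biprod.inl Z ε + push E biprod.inr Z ε'

namespace Extriangulation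

section Additivity

variable (s : Extriangulation E)

include s

theorem push_add {A A' : C} (a b : A ⟶ A') {Z : C} (δ : Extn E Z A) :
    push E (a + b) Z δ = push E a Z δ + push E b Z δ := by
  have := s.additive_right (op Z)
  simp [push, Functor.map_add]

theorem pull_add {Z Z' : C} (a b : Z' ⟶ Z) {A : C} (δ : Extn E Z A) :
    pull E (a + b) A δ = pull E a A δ + pull E b A δ := by
  have := s.additive_left A
  exact ConcreteCategory.congr_hom ((E.flip.obj A).map_add (f := a.op) (g := b.op)) δ

theorem push_zero {A A' Z : C} (δ : Extn E Z A) : push E (0 : A ⟶ A') Z δ = 0 := by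
  simpa using s.push_add (0 : A ⟶ A') 0 δ

theorem pull_zero {Z Z' A : C} (δ : Extn E Z A) : pull E (0 : Z' ⟶ Z) A δ = 0 := by
  simpa using s.pull_add (0 : Z' ⟶ Z) 0 δ

theorem push_sub {A A' : C} (a b : A ⟶ A') {Z : C} (δ : Extn E Z A) :
    push E (a - b) Z δ = push E a Z δ - push E b Z δ := by
  rw [eq_sub_iff_add_eq, ← s.push_add, sub_add_cancel]

theorem push_fst_extLift {Z V W : C} (ε : Extn E Z V) (ε' : Extn E Z W) :
    push E biprod.fst Z (extLift ε ε') = ε := by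
  rw [extLift, map_add, ← push_comp, ← push_comp, biprod.inl_fst, biprod.inr_fst, push_id,
    s.push_zero, add_zero]

theorem push_snd_extLift {Z V W : C} (ε : Extn E Z V) (ε' : Extn E Z W) :
    push E biprod.snd Z (extLift ε ε') = ε' := by
  rw [extLift, map_add, ← push_comp, ← push_comp, biprod.inl_snd, biprod.inr_snd, push_id,
    s.push_zero, zero_add]

end Additivity

variable {s : Extriangulation E} {A B Z : C} {x : A ⟶ B} {y : B ⟶ Z} {δ : Extn E Z A}

theorem inflation_comp_deflation (h : s.Real x y δ) : x ≫ y = 0 := by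
  obtain ⟨c, hc, -⟩ := s.et3 (s.real_zero A Z) h (𝟙 A) (biprod.fst ≫ x) (by simp)
  simpa using (congrArg (biprod.inl ≫ ·) hc).symm

theorem pull_deflation (h : s.Real x y δ) : pull E y A δ = 0 := by
  obtain ⟨a, -, ha⟩ := s.et3_op (s.real_zero A B) h biprod.snd y rfl
  rw [← ha, map_zero]

theorem exists_inflation_comp_eq (h : s.Real x y δ) {W : C} (f : A ⟶ W)
    (hf : push E f Z δ = 0) : ∃ g : B ⟶ W, x ≫ g = f := by
  obtain ⟨b, hb, -⟩ := s.real_lift h (s.real_zero W Z) f (𝟙 Z) (by rw [hf, map_zero])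
  exact ⟨b ≫ biprod.fst, by simp [reassoc_of% hb]⟩

theorem exists_comp_deflation_eq (h : s.Real x y δ) {W : C} (f : W ⟶ Z)
    (hf : pull E f A δ = 0) : ∃ g : W ⟶ B, g ≫ y = f := by
  obtain ⟨b, -, hb⟩ := s.real_lift (s.real_zero A W) h (𝟙 A) f (by rw [hf, map_zero])
  exact ⟨biprod.inr ≫ b, by simp [← hb]⟩

theorem exists_deflation_comp_eq (h : s.Real x y δ) {W : C} (f : B ⟶ W)
    (hf : x ≫ f = 0) : ∃ g : Z ⟶ W, y ≫ g = f := by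
  obtain ⟨c, hc, -⟩ := s.et3 h (s.real_zero W W) 0 (f ≫ biprod.inr) (by simp [reassoc_of% hf])
  exact ⟨c, by simpa using hc⟩

theorem exists_pull_eq (h : s.Real x y δ) {Y : C} (ε : Extn E Y A)
    (hε : push E x Y ε = 0) : ∃ c : Y ⟶ Z, pull E c A δ = ε := by
  obtain ⟨V, i, p, hV⟩ := s.exists_real ε
  obtain ⟨b, hb⟩ := exists_inflation_comp_eq hV x hε
  obtain ⟨c, -, hc⟩ := s.et3 hV h (𝟙 A) b (by rw [hb, Category.id_comp])
  exact ⟨c, by rw [← hc, push_id]⟩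

theorem exists_push_eq (h : s.Real x y δ) {Y : C} (ε : Extn E Z Y)
    (hε : pull E y Y ε = 0) : ∃ a : A ⟶ Y, push E a Z δ = ε := by
  obtain ⟨V, i, p, hV⟩ := s.exists_real ε
  obtain ⟨b, hb⟩ := exists_comp_deflation_eq hV y hε
  obtain ⟨a, -, ha⟩ := s.et3_op h hV b (𝟙 Z) (by rw [hb, Category.comp_id])
  exact ⟨a, by rw [ha, pull_id]⟩

theorem exists_push_inflation_eq (h : s.Real x y δ) {Y : C} (ε : Extn E Y B)
    (hε : push E y Y ε = 0) : ∃ ε' : Extn E Y A, push E x Y ε' = ε := by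
  obtain ⟨V, i, p, hV⟩ := s.exists_real ε
  obtain ⟨K, d, e, k, ζ, -, -, -, hK, -, hζ⟩ := s.et4 h hV
  obtain ⟨t, ht⟩ := exists_comp_deflation_eq hK (𝟙 Y) (by rw [hε, map_zero])
  exact ⟨pull E t A ζ, by rw [← pull_push, hζ, ← pull_comp, ht, pull_id]⟩

/-! ### Operations on `𝔼`-triangles -/

theorem isIso_of_endo (h : s.Real x y δ) (b : B ⟶ B) (hx : x ≫ b = x) (hy : b ≫ y = y) :
    IsIso b := by
  obtain ⟨m, hm⟩ := exists_deflation_comp_eq h (b - 𝟙 B) (by simp [hx])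
  have hsq : (b - 𝟙 B) ≫ (b - 𝟙 B) = 0 := by
    rw [← hm, Category.assoc, ← Category.assoc m, ← Category.assoc, ← Category.assoc, hm]
    simp [hy]
  let n : End B := b - 𝟙 B
  have hn : IsNilpotent n := ⟨2, by rw [sq]; exact hsq⟩
  have hb : 1 + n = b := add_sub_cancel (𝟙 B) b
  exact (isUnit_iff_isIso b).mp (hb ▸ hn.isUnit_one_add)

theorem isIso_of_isIso {A' B' Z' : C} {x' : A' ⟶ B'} {y' : B' ⟶ Z'} {δ' : Extn E Z' A'}
    (h : s.Real x y δ) (h' : s.Real x' y' δ') (a : A ≅ A') (c : Z ≅ Z')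
    (hac : push E a.hom Z δ = pull E c.hom A' δ') (b : B ⟶ B')
    (hx : x ≫ b = a.hom ≫ x') (hy : y ≫ c.hom = b ≫ y') : IsIso b := by
  have hδ' : push E a.inv Z' δ' = pull E c.inv A δ := by
    rw [← push_id E Z A δ, ← a.hom_inv_id, push_comp, hac, ← pull_push, ← pull_comp, c.inv_hom_id,
      pull_id]
  obtain ⟨b', hx', hy'⟩ := s.real_lift h' h a.inv c.inv hδ'
  have : IsIso (b ≫ b') := isIso_of_endo h _
    (by simp [reassoc_of% hx, hx']) (by simp [← hy', ← reassoc_of% hy])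
  have : IsIso (b' ≫ b) := isIso_of_endo h' _
    (by simp [reassoc_of% hx', hx]) (by simp [← hy, ← reassoc_of% hy'])
  have : Mono b := mono_of_mono b b'
  have : IsSplitEpi b := .mk' ⟨inv (b' ≫ b) ≫ b', by simp⟩
  exact isIso_of_mono_of_isSplitEpi b

theorem real_of_iso_ends (h : s.Real x y δ) {A' Z' : C} (a : A ≅ A') (c : Z ≅ Z') :
    s.Real (a.inv ≫ x) (y ≫ c.hom) (pull E c.inv A' (push E a.hom Z δ)) := by
  obtain ⟨B', x', y', h'⟩ := s.exists_real (pull E c.inv A' (push E a.hom Z δ))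
  have hac : push E a.hom Z δ = pull E c.hom A' (pull E c.inv A' (push E a.hom Z δ)) := by
    rw [← pull_comp, c.hom_inv_id, pull_id]
  obtain ⟨b, hx, hy⟩ := s.real_lift h h' a.hom c.hom hac
  have : IsIso b := isIso_of_isIso h h' a c hac b hx hy
  convert s.real_of_iso (asIso b).symm h' using 1
  · simp [hx]
  · simpa using hy

theorem Tri.congr {A' B' Z' : C} (h : s.Tri A B Z) (a : A ≅ A') (b : B ≅ B') (c : Z ≅ Z') :
    s.Tri A' B' Z' := by
  obtain ⟨x, y, δ, h⟩ := h
  exact ⟨_, _, _, s.real_of_iso b (real_of_iso_ends h a c)⟩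

theorem tri_biprod (s : Extriangulation E) (A Z : C) : s.Tri A (A ⊞ Z) Z :=
  ⟨_, _, _, s.real_zero A Z⟩

theorem tri_swap_of_real_zero (h : s.Real x y 0) : s.Tri Z B A := by
  obtain ⟨e, -, -⟩ := s.real_unique h (s.real_zero A Z)
  exact (s.tri_biprod Z A).congr (Iso.refl Z) (biprod.braiding Z A ≪≫ e.symm) (Iso.refl A)

theorem real_zero_of_isZero (s : Extriangulation E) {O : C} (hO : IsZero O) (Z : C) :
    s.Real (0 : O ⟶ Z) (𝟙 Z) (0 : Extn E Z O) := by
  have h := s.real_of_iso (isoZeroBiprod hO).symm (s.real_zero O Z)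
  rwa [hO.eq_of_src (_ ≫ _) 0, show (isoZeroBiprod hO).symm.inv ≫ biprod.snd = 𝟙 Z from
    biprod.inr_snd] at h

theorem Tri.comp_inflation {D G H : C} (h : s.Tri A B D) (h' : s.Tri B G H) :
    ∃ K : C, s.Tri A G K ∧ s.Tri D K H := by
  obtain ⟨_, _, _, h⟩ := h
  obtain ⟨_, _, _, h'⟩ := h'
  obtain ⟨K, _, _, _, _, hK, -, -, hK', -, -⟩ := s.et4 h h'
  exact ⟨K, ⟨_, _, _, hK⟩, ⟨_, _, _, hK'⟩⟩

theorem Tri.comp_deflation {D H G : C} (h : s.Tri D A B) (h' : s.Tri H B G) :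
    ∃ K : C, s.Tri K A G ∧ s.Tri D K H := by
  obtain ⟨_, _, _, h⟩ := h
  obtain ⟨_, _, _, h'⟩ := h'
  obtain ⟨K, _, _, _, _, hK, -, -, hK', -, -⟩ := s.et4_op h h'
  exact ⟨K, ⟨_, _, _, hK⟩, ⟨_, _, _, hK'⟩⟩

theorem exists_real_of_retraction (h : s.Real x y 0) {q : B ⟶ A} (hq : x ≫ q = 𝟙 A) :
    ∃ j : Z ⟶ B, s.Real j q 0 := by
  obtain ⟨u, hx, -⟩ := s.real_unique h (s.real_zero A Z)
  let t : Z ⟶ A := biprod.inr ≫ u.inv ≫ q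
  have hdesc : u.hom ≫ biprod.desc (𝟙 A) t = q := by
    rw [← Iso.eq_inv_comp]
    ext
    · rw [biprod.inl_desc, ← hx, Category.assoc, u.hom_inv_id_assoc, hq]
    · simp [t]
  let e : Z ⊞ A ≅ A ⊞ Z :=
    { hom := biprod.desc (biprod.lift (-t) (𝟙 Z)) biprod.inl
      inv := biprod.lift biprod.snd (biprod.desc (𝟙 A) t)
      hom_inv_id := by ext <;> simp
      inv_hom_id := by ext <;> simp }
  refine ⟨biprod.inl ≫ e.hom ≫ u.inv, ?_⟩
  simpa [e, hdesc] using s.real_of_iso (e ≪≫ u.symm) (s.real_zero Z A)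

theorem exists_tri_pullback {A₁ A₂ B₁ B₂ : C} (h₁ : s.Tri A₁ B₁ Z) (h₂ : s.Tri A₂ B₂ Z) :
    ∃ M : C, s.Tri A₁ M B₂ ∧ s.Tri A₂ M B₁ := by
  obtain ⟨x₁, y₁, δ₁, h₁⟩ := h₁
  obtain ⟨x₂, y₂, δ₂, h₂⟩ := h₂
  obtain ⟨M, i, p, hM⟩ := s.exists_real (pull E y₂ A₁ δ₁)
  refine ⟨M, ⟨_, _, _, hM⟩, ?_⟩
  obtain ⟨K, d, e, k, ε, hk, -, -, hK, heε, hdε⟩ := s.et4_op hM h₂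
  rw [← pull_comp, inflation_comp_deflation h₂, s.pull_zero] at hK
  -- A retraction of `d` pushes `ε` to `δ₁` only up to an extension pushed forward from `δ₂`.
  obtain ⟨r, hr⟩ := exists_inflation_comp_eq hK (𝟙 A₁) (map_zero _)
  obtain ⟨t, ht⟩ := exists_push_eq h₂ (push E r Z ε - δ₁) (by
    rw [map_sub, pull_push, ← hdε, ← push_comp, hr, push_id, sub_self])
  have hq : d ≫ (r - e ≫ t) = 𝟙 A₁ := by
    rw [Preadditive.comp_sub, hr, reassoc_of% inflation_comp_deflation hK, zero_comp, sub_zero]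
  have hqε : push E (r - e ≫ t) Z ε = δ₁ := by
    rw [s.push_sub, push_comp, heε, ht, sub_sub_cancel]
  obtain ⟨j, hj⟩ := exists_real_of_retraction hK hq
  obtain ⟨L, _, _, _, _, hL, -, -, hL', -, -⟩ := s.et4 hj hk
  rw [hqε] at hL'
  obtain ⟨u, -, -⟩ := s.real_unique hL' h₁
  exact Tri.congr ⟨_, _, _, hL⟩ (Iso.refl _) (Iso.refl _) u

theorem exists_tri_of_extn_subsingleton {W M V N : C} (h : s.Tri A W M) (h' : s.Tri W V N)
    (hNM : Subsingleton (Extn E N M)) : ∃ L : C, s.Tri L V M ∧ s.Tri A L N := by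
  obtain ⟨K, hK, x, y, δ, hK'⟩ := h.comp_inflation h'
  obtain rfl : δ = 0 := Subsingleton.elim _ _
  exact hK.comp_deflation (tri_swap_of_real_zero hK')

theorem extn_subsingleton_of_tri {N Y N' M I M' : C} (h : s.Tri N Y N') (h' : s.Tri M I M')
    (hNI : Subsingleton (Extn E N I)) (hNM' : Subsingleton (Extn E N' M'))
    (hYM : Subsingleton (Extn E Y M)) : Subsingleton (Extn E N M) := by
  obtain ⟨x, y, δ, h⟩ := h
  obtain ⟨x', y', δ', h'⟩ := h'
  refine subsingleton_of_forall_eq 0 fun ε => ?_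
  obtain ⟨c, rfl⟩ := exists_pull_eq h' ε (Subsingleton.elim _ _)
  obtain ⟨c, rfl⟩ := exists_inflation_comp_eq h c (Subsingleton.elim _ _)
  rw [pull_comp, Subsingleton.elim (pull E c M δ') 0, map_zero]

theorem exists_real_desc [HasZeroObject C] (h : s.Real x y δ) {Y : C} (f : Y ⟶ Z) :
    ∃ (K : C) (k : K ⟶ Y ⊞ B) (ε : Extn E Z K), s.Real k (biprod.desc f y) ε ∧ s.Tri A K Y := by
  obtain ⟨O, hO⟩ := HasZeroObject.zero (C := C)
  have hsum := s.real_sum (s.real_zero_of_isZero hO Y) h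
  let e : Y ⊞ Z ≅ Y ⊞ Z :=
    { hom := biprod.lift biprod.fst (biprod.snd - biprod.fst ≫ f)
      inv := biprod.lift biprod.fst (biprod.snd + biprod.fst ≫ f)
      hom_inv_id := by ext <;> simp
      inv_hom_id := by ext <;> simp }
  obtain ⟨K, d, e', k, ε, hk, -, -, hd, -, -⟩ :=
    s.et4_op hsum (s.real_of_iso e (s.real_zero Y Z))
  have hdesc : biprod.map (𝟙 Y) y ≫ e.inv ≫ biprod.snd = biprod.desc f y := by
    ext <;> simp [e]
  rw [hdesc] at hk
  exact ⟨K, k, ε, hk, Tri.congr ⟨_, _, _, hd⟩ (isoZeroBiprod hO).symm (Iso.refl K) (Iso.refl Y)⟩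

end Extriangulation

end Triangles

/-! ### The coend `F ⋄ 𝔼` -/

section Coend

variable {C : Type u} [Category.{v} C] {E : Cᵒᵖ ⥤ C ⥤ AddCommGrpCat.{w}}
  {F G H : Cᵒᵖ ⥤ AddCommGrpCat.{max u w}}

/-- The element `x ⊗ δ` of `(F ⋄ 𝔼)(Z)`. -/
def tmul {Z X : C} (x : F.obj (op X)) (δ : Extn E Z X) : CoendObj E F Z :=
  QuotientAddGroup.mk (FreeAbelianGroup.of ⟨X, x, δ⟩)

theorem mk_eq_zero_of_rel {Z : C} {r : FreeAbelianGroup (CoendGen E F Z)}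
    (hr : CoendRel E F Z r) : (QuotientAddGroup.mk r : CoendObj E F Z) = 0 :=
  (QuotientAddGroup.eq_zero_iff r).mpr (AddSubgroup.subset_closure hr)

theorem add_tmul {Z X : C} (x x' : F.obj (op X)) (δ : Extn E Z X) :
    tmul (x + x') δ = tmul x δ + tmul x' δ := by
  have h := mk_eq_zero_of_rel (CoendRel.add_left (E := E) X x x' δ)
  rwa [QuotientAddGroup.mk_sub, QuotientAddGroup.mk_sub, sub_sub, sub_eq_zero] at h

theorem tmul_add {Z X : C} (x : F.obj (op X)) (δ δ' : Extn E Z X) :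
    tmul x (δ + δ') = tmul x δ + tmul x δ' := by
  have h := mk_eq_zero_of_rel (CoendRel.add_right (E := E) X x δ δ')
  rwa [QuotientAddGroup.mk_sub, QuotientAddGroup.mk_sub, sub_sub, sub_eq_zero] at h

theorem map_tmul {Z X Y : C} (f : X ⟶ Y) (x : F.obj (op Y)) (δ : Extn E Z X) :
    tmul ((F.map f.op).hom x) δ = tmul x (push E f Z δ) := by
  have h := mk_eq_zero_of_rel (CoendRel.balanced (E := E) f x δ)
  rwa [QuotientAddGroup.mk_sub, sub_eq_zero] at h

theorem zero_tmul {Z X : C} (δ : Extn E Z X) : tmul (0 : F.obj (op X)) δ = 0 := by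
  simpa using add_tmul (0 : F.obj (op X)) 0 δ

theorem tmul_zero {Z X : C} (x : F.obj (op X)) : tmul x (0 : Extn E Z X) = 0 := by
  simpa using tmul_add x (0 : Extn E Z X) 0

theorem neg_tmul {Z X : C} (x : F.obj (op X)) (δ : Extn E Z X) : tmul (-x) δ = - tmul x δ := by
  rw [eq_neg_iff_add_eq_zero, ← add_tmul, neg_add_cancel, zero_tmul]

theorem coendFunctor_map_tmul {Z Z' X : C} (c : Z' ⟶ Z) (x : F.obj (op X)) (δ : Extn E Z X) :
    ((coendFunctor E F).map c.op).hom (tmul x δ) = tmul x (pull E c X δ) := by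
  change QuotientAddGroup.mk (coendGenMap E F c (FreeAbelianGroup.of ⟨X, x, δ⟩)) = _
  rw [coendGenMap_of]
  rfl

theorem coend_addHom_ext {Z : C} {M : Type*} [AddCommGroup M] {f g : CoendObj E F Z →+ M}
    (h : ∀ (X : C) (x : F.obj (op X)) (δ : Extn E Z X), f (tmul x δ) = g (tmul x δ)) : f = g :=
  QuotientAddGroup.addMonoidHom_ext _
    (FreeAbelianGroup.lift_ext _ _ fun ⟨X, x, δ⟩ => h X x δ)

/-- The map `[x, δ] ↦ φ(x) ⊗ δ` on the free group of generators of `(F ⋄ 𝔼)(Z)`. -/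
def coendTransGen (φ : F ⟶ G) (Z : C) : FreeAbelianGroup (CoendGen E F Z) →+ CoendObj E G Z :=
  FreeAbelianGroup.lift fun g => tmul ((φ.app (op g.1)).hom g.2.1) g.2.2

theorem coendTransGen_of (φ : F ⟶ G) {Z X : C} (x : F.obj (op X)) (δ : Extn E Z X) :
    coendTransGen φ Z (FreeAbelianGroup.of ⟨X, x, δ⟩) = tmul ((φ.app (op X)).hom x) δ :=
  FreeAbelianGroup.lift_apply_of _ _

theorem coendRelSubgroup_le_ker_coendTransGen (φ : F ⟶ G) (Z : C) :
    coendRelSubgroup E F Z ≤ (coendTransGen φ Z).ker := by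
  rw [coendRelSubgroup, AddSubgroup.closure_le]
  intro r hr
  rw [SetLike.mem_coe, AddMonoidHom.mem_ker]
  cases hr with
  | add_left X x x' δ =>
    simp only [map_sub, coendTransGen_of, map_add, add_tmul]
    abel
  | add_right X x δ δ' =>
    simp only [map_sub, coendTransGen_of, tmul_add]
    abel
  | @balanced X Y f x δ =>
    have hφ : (φ.app (op X)).hom ((F.map f.op).hom x) = (G.map f.op).hom ((φ.app (op Y)).hom x) :=
      ConcreteCategory.congr_hom (φ.naturality f.op) x
    rw [map_sub, coendTransGen_of, coendTransGen_of, hφ, map_tmul, sub_self]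

/-- The map `(F ⋄ 𝔼)(Z) → (G ⋄ 𝔼)(Z)`, `x ⊗ δ ↦ φ(x) ⊗ δ`. -/
def coendTransApp (φ : F ⟶ G) (Z : C) : CoendObj E F Z →+ CoendObj E G Z :=
  QuotientAddGroup.lift _ (coendTransGen φ Z) (coendRelSubgroup_le_ker_coendTransGen φ Z)

theorem coendTransApp_tmul (φ : F ⟶ G) {Z X : C} (x : F.obj (op X)) (δ : Extn E Z X) :
    coendTransApp φ Z (tmul x δ) = tmul ((φ.app (op X)).hom x) δ :=
  coendTransGen_of φ x δ

/-- The natural transformation `φ ⋄ 𝔼 : F ⋄ 𝔼 ⟶ G ⋄ 𝔼`. -/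
def coendTrans (φ : F ⟶ G) : coendFunctor E F ⟶ coendFunctor E G where
  app Z := AddCommGrpCat.ofHom (coendTransApp φ Z.unop)
  naturality Z Z' c := by
    refine AddCommGrpCat.hom_ext (coend_addHom_ext fun X x δ => ?_)
    change coendTransApp φ Z'.unop (((coendFunctor E F).map c.unop.op).hom (tmul x δ)) =
      ((coendFunctor E G).map c.unop.op).hom (coendTransApp φ Z.unop (tmul x δ))
    rw [coendFunctor_map_tmul, coendTransApp_tmul, coendTransApp_tmul, coendFunctor_map_tmul]

theorem coendTrans_app_tmul (φ : F ⟶ G) {Z X : C} (x : F.obj (op X)) (δ : Extn E Z X) :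
    ((coendTrans (E := E) φ).app (op Z)).hom (tmul x δ) = tmul ((φ.app (op X)).hom x) δ :=
  coendTransApp_tmul φ x δ

theorem succExtVanishes_zero_iff {Y A : C} :
    SuccExtVanishes E 0 Y A ↔ Subsingleton (Extn E Y A) :=
  Equiv.ulift.subsingleton_congr

/-- The natural map `𝔼^{i+1}(-, A) ⟶ 𝔼^{i+1}(-, A')` induced by `a : A ⟶ A'`. -/
def posExtMap (E : Cᵒᵖ ⥤ C ⥤ AddCommGrpCat.{w}) {A A' : C} (a : A ⟶ A') :
    ∀ i : ℕ, posExt E A i ⟶ posExt E A' i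
  | 0 => Functor.whiskerRight (E.flip.map a) _
  | i + 1 => coendTrans (posExtMap E a i)

/-- The connecting map `𝔼(-, Z) ⟶ 𝔼²(-, A)`, `ε ↦ δ ⊗ ε`. -/
def firstConnecting {A Z : C} (δ : Extn E Z A) : posExt E Z 0 ⟶ posExt E A 1 where
  app Y := AddCommGrpCat.ofHom
    (AddMonoidHom.mk' (fun ε => tmul (F := posExt E A 0) (ULift.up δ) (ULift.down ε))
      fun ε ε' => tmul_add _ _ _)
  naturality Y Y' c := by
    ext ε
    exact (coendFunctor_map_tmul c.unop _ _).symm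

/-- The connecting map `𝔼^{i+1}(-, Z) ⟶ 𝔼^{i+2}(-, A)` of an extension of `Z` by `A`. -/
def connecting {A Z : C} (δ : Extn E Z A) : ∀ i : ℕ, posExt E Z i ⟶ posExt E A (i + 1)
  | 0 => firstConnecting δ
  | i + 1 => coendTrans (connecting δ i)

/-- The half `ker ψ ⊆ im φ` of the exactness of `F ⟶ G ⟶ H` at `G`. -/
def KerLeRange (φ : F ⟶ G) (ψ : G ⟶ H) : Prop :=
  ∀ (Z : C) (y : G.obj (op Z)), (ψ.app (op Z)).hom y = 0 → ∃ x, (φ.app (op Z)).hom x = y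

theorem KerLeRange.subsingleton {φ : F ⟶ G} {ψ : G ⟶ H} (h : KerLeRange φ ψ) (Z : C)
    (hF : Subsingleton (F.obj (op Z))) (hH : Subsingleton (H.obj (op Z))) :
    Subsingleton (G.obj (op Z)) := by
  refine subsingleton_of_forall_eq 0 fun y => ?_
  obtain ⟨x, rfl⟩ := h Z y (Subsingleton.elim _ _)
  rw [Subsingleton.elim x 0, map_zero]

theorem map_comp_apply {X Y Z : C} (f : X ⟶ Y) (g : Y ⟶ Z) (x : F.obj (op Z)) :
    (F.map (f ≫ g).op).hom x = (F.map f.op).hom ((F.map g.op).hom x) := by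
  simp

/-- The pairs `(∑ nᵢ [Xᵢ, xᵢ, δᵢ], ∑ nᵢ uᵢ^* xᵢ)` with `uᵢ : V ⟶ Xᵢ` such that `(uᵢ)_* ε = δᵢ`:
the balancing relation identifies `∑ nᵢ xᵢ ⊗ δᵢ` with `(∑ nᵢ uᵢ^* xᵢ) ⊗ ε`. -/
def representatives (F : Cᵒᵖ ⥤ AddCommGrpCat.{max u w}) {Z V : C} (ε : Extn E Z V) :
    AddSubgroup (FreeAbelianGroup (CoendGen E F Z) × F.obj (op V)) :=
  AddSubgroup.closure {q | ∃ (X : C) (x : F.obj (op X)) (f : V ⟶ X),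
    q = (FreeAbelianGroup.of ⟨X, x, push E f Z ε⟩, (F.map f.op).hom x)}

theorem of_mem_representatives {Z V X : C} (ε : Extn E Z V) (x : F.obj (op X)) (f : V ⟶ X)
    {δ : Extn E Z X} (h : push E f Z ε = δ) :
    (FreeAbelianGroup.of ⟨X, x, δ⟩, (F.map f.op).hom x) ∈ representatives F ε :=
  AddSubgroup.subset_closure ⟨X, x, f, by rw [h]⟩

theorem map_mem_representatives {Z V W : C} {ε : Extn E Z V} {ζ : Extn E Z W} (f : W ⟶ V)
    (h : push E f Z ζ = ε) {r : FreeAbelianGroup (CoendGen E F Z)} {y : F.obj (op V)}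
    (hr : (r, y) ∈ representatives F ε) : (r, (F.map f.op).hom y) ∈ representatives F ζ := by
  have hle : representatives F ε ≤ (representatives F ζ).comap
      ((AddMonoidHom.id _).prodMap (F.map f.op).hom) := by
    rw [representatives, AddSubgroup.closure_le]
    rintro _ ⟨X, x, g, rfl⟩
    change (_, (F.map f.op).hom ((F.map g.op).hom x)) ∈ representatives F ζ
    rw [← map_comp_apply]
    exact of_mem_representatives ζ x (f ≫ g) (by rw [push_comp, h])
  exact hle hr

end Coend

/-! ### Tensors in effaceable functors -/

section Effaceable

variable {C : Type u} [Category.{v} C] [Preadditive C] [HasBinaryBiproducts C]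
  {E : Cᵒᵖ ⥤ C ⥤ AddCommGrpCat.{w}} {F : Cᵒᵖ ⥤ AddCommGrpCat.{max u w}}

theorem exists_tmul (s : Extriangulation E) {Z : C} (t : CoendObj E F Z) :
    ∃ (X : C) (x : F.obj (op X)) (δ : Extn E Z X), tmul x δ = t := by
  obtain ⟨r, rfl⟩ := QuotientAddGroup.mk_surjective t
  induction r using FreeAbelianGroup.induction_on with
  | zero => exact ⟨Z, 0, 0, zero_tmul _⟩
  | of g => exact ⟨g.1, g.2.1, g.2.2, rfl⟩
  | neg g h =>
    obtain ⟨X, x, δ, h⟩ := h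
    exact ⟨X, -x, δ, by rw [neg_tmul, h]; rfl⟩
  | add a b ha hb =>
    obtain ⟨X, x, δ, ha⟩ := ha
    obtain ⟨X', x', δ', hb⟩ := hb
    refine ⟨X ⊞ X', (F.map (biprod.fst : X ⊞ X' ⟶ X).op).hom x +
      (F.map (biprod.snd : X ⊞ X' ⟶ X').op).hom x', extLift δ δ', ?_⟩
    rw [add_tmul, map_tmul, map_tmul, s.push_fst_extLift, s.push_snd_extLift, ha, hb]
    rfl

/-- An additive contravariant functor each of whose elements is killed by some deflation. -/
structure IsEffaceable (s : Extriangulation E) (F : Cᵒᵖ ⥤ AddCommGrpCat.{max u w}) : Prop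
    extends F.Additive where
  efface : ∀ {W : C} (x : F.obj (op W)), ∃ (K V : C) (i : K ⟶ V) (p : V ⟶ W) (ε : Extn E W K),
    s.Real i p ε ∧ (F.map p.op).hom x = 0

theorem IsEffaceable.map_add_apply {s : Extriangulation E} (hF : IsEffaceable s F) {X Y : C}
    (f g : X ⟶ Y) (x : F.obj (op Y)) :
    (F.map (f + g).op).hom x = (F.map f.op).hom x + (F.map g.op).hom x := by
  have := hF.toAdditive
  rw [op_add, F.map_add]
  rfl

theorem IsEffaceable.map_sub_apply {s : Extriangulation E} (hF : IsEffaceable s F) {X Y : C}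
    (f g : X ⟶ Y) (x : F.obj (op Y)) :
    (F.map (f - g).op).hom x = (F.map f.op).hom x - (F.map g.op).hom x := by
  rw [eq_sub_iff_add_eq, ← hF.map_add_apply, sub_add_cancel]

theorem IsEffaceable.posExt_zero (s : Extriangulation E) (A : C) :
    IsEffaceable s (posExt E A 0) where
  map_add {_ _ f g} := by
    ext x
    exact ULift.ext _ _ (s.pull_add f.unop g.unop (ULift.down x))
  efface {W} x := by
    obtain ⟨V, i, p, h⟩ := s.exists_real (ULift.down x : Extn E W A)
    exact ⟨A, V, i, p, _, h, ULift.ext _ _ (Extriangulation.pull_deflation h)⟩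

theorem IsEffaceable.coend (s : Extriangulation E) (F : Cᵒᵖ ⥤ AddCommGrpCat.{max u w}) :
    IsEffaceable s (coendFunctor E F) where
  map_add {_ _ f g} := by
    refine AddCommGrpCat.hom_ext (coend_addHom_ext fun X x δ => ?_)
    change ((coendFunctor E F).map (f.unop + g.unop).op).hom (tmul x δ) =
      ((coendFunctor E F).map f.unop.op).hom (tmul x δ) +
        ((coendFunctor E F).map g.unop.op).hom (tmul x δ)
    simp only [coendFunctor_map_tmul, s.pull_add, tmul_add]
    rfl
  efface {W} x := by
    obtain ⟨X, x, δ, rfl⟩ := exists_tmul s x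
    obtain ⟨V, i, p, h⟩ := s.exists_real δ
    refine ⟨X, V, i, p, _, h, ?_⟩
    rw [coendFunctor_map_tmul, Extriangulation.pull_deflation h, tmul_zero]
    rfl

theorem IsEffaceable.posExt (s : Extriangulation E) (A : C) (i : ℕ) :
    IsEffaceable s (posExt E A i) := by
  cases i with
  | zero => exact posExt_zero s A
  | succ i => exact coend s _

/-- The pull-back of `x` vanishes along some `w : V' ⟶ V` through which `ε ∈ 𝔼(Z, V)` lifts to
`𝔼(Z, V')`. This implies `x ⊗ ε = 0`, and the converse holds if `F` is effaceable. -/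
def RefinesToZero (F : Cᵒᵖ ⥤ AddCommGrpCat.{max u w}) {Z V : C} (ε : Extn E Z V)
    (x : F.obj (op V)) : Prop :=
  ∃ (V' : C) (w : V' ⟶ V) (ε' : Extn E Z V'), push E w Z ε' = ε ∧ (F.map w.op).hom x = 0

namespace IsEffaceable

variable {s : Extriangulation E} (hF : IsEffaceable s F)

include hF

theorem refinesToZero_map {Z V W : C} (ε : Extn E Z V) (h : V ⟶ W) (hε : push E h Z ε = 0)
    (x : F.obj (op W)) : RefinesToZero F ε ((F.map h.op).hom x) := by
  obtain ⟨B, i, p, hB⟩ := s.exists_real ε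
  obtain ⟨c, rfl⟩ := Extriangulation.exists_inflation_comp_eq hB h hε
  obtain ⟨K, V', j, q, ζ, hq, hx⟩ := hF.efface ((F.map c.op).hom x)
  obtain ⟨N, d, e, k, ε', -, -, hke, -, hε', -⟩ := s.et4_op hq hB
  refine ⟨N, e, ε', hε', ?_⟩
  rw [← map_comp_apply, ← Category.assoc, ← hke, Category.assoc, map_comp_apply,
    map_comp_apply, hx, map_zero]

theorem refinesToZero_map_sub_map {Z V W : C} (ε : Extn E Z V) (a b : V ⟶ W)
    (h : push E a Z ε = push E b Z ε) (x : F.obj (op W)) :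
    RefinesToZero F ε ((F.map a.op).hom x - (F.map b.op).hom x) := by
  rw [← hF.map_sub_apply]
  exact hF.refinesToZero_map ε _ (by rw [s.push_sub, h, sub_self]) x

theorem refinesToZero_add {Z V : C} {ε : Extn E Z V} {x y : F.obj (op V)}
    (hx : RefinesToZero F ε x) (hy : RefinesToZero F ε y) : RefinesToZero F ε (x + y) := by
  obtain ⟨V₁, w₁, ε₁, h₁, hx⟩ := hx
  obtain ⟨V₂, w₂, ε₂, h₂, hy⟩ := hy
  obtain ⟨V', v, ε', hv, hz⟩ := hF.refinesToZero_map_sub_map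
    (extLift ε₁ ε₂) (biprod.fst ≫ w₁) (biprod.snd ≫ w₂)
    (by rw [push_comp, push_comp, s.push_fst_extLift, s.push_snd_extLift, h₁, h₂]) y
  rw [map_comp_apply biprod.snd, hy, map_zero, sub_zero] at hz
  refine ⟨V', v ≫ biprod.fst ≫ w₁, ε', ?_, ?_⟩
  · rw [push_comp, hv, push_comp, s.push_fst_extLift, h₁]
  · rw [map_comp_apply, map_add, map_add, hz, add_zero, map_comp_apply, hx, map_zero, map_zero]

end IsEffaceable

/-- The elements that refine to zero along `ε`. -/
def IsEffaceable.refinedKernel {s : Extriangulation E} (hF : IsEffaceable s F) {Z V : C}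
    (ε : Extn E Z V) : AddSubgroup (F.obj (op V)) where
  carrier := {x | RefinesToZero F ε x}
  zero_mem' := ⟨V, 𝟙 V, ε, push_id E _ _ _, map_zero _⟩
  add_mem' := hF.refinesToZero_add
  neg_mem' := fun ⟨V', w, ε', hε, hx⟩ => ⟨V', w, ε', hε, by rw [map_neg, hx, neg_zero]⟩

theorem CoendRel.exists_zero_mem_representatives {s : Extriangulation E} (hF : IsEffaceable s F)
    {Z : C} {r : FreeAbelianGroup (CoendGen E F Z)} (hr : CoendRel E F Z r) :
    ∃ (V : C) (ε : Extn E Z V), (r, 0) ∈ representatives F ε := by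
  cases hr with
  | add_left X x x' δ =>
    refine ⟨X, δ, ?_⟩
    have h (x : F.obj (op X)) := of_mem_representatives δ x (𝟙 X) (push_id E _ _ _)
    convert sub_mem (sub_mem (h (x + x')) (h x)) (h x') using 1
    ext <;> simp
  | add_right X x δ δ' =>
    refine ⟨X ⊞ X, extLift δ δ', ?_⟩
    have hfst := of_mem_representatives _ x biprod.fst (s.push_fst_extLift δ δ')
    have hsnd := of_mem_representatives _ x biprod.snd (s.push_snd_extLift δ δ')
    have hsum := of_mem_representatives (extLift δ δ') x (biprod.fst + biprod.snd)
      (by rw [s.push_add, s.push_fst_extLift, s.push_snd_extLift])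
    convert sub_mem (sub_mem hsum hfst) hsnd using 1
    ext
    · simp
    · simp only [Prod.snd_sub, hF.map_add_apply]
      abel
  | @balanced X Y f x δ =>
    refine ⟨X, δ, ?_⟩
    have hmap := of_mem_representatives δ ((F.map f.op).hom x) (𝟙 X) (push_id E _ _ _)
    have hpush := of_mem_representatives δ x f rfl
    convert sub_mem hmap hpush using 1
    ext <;> simp

theorem IsEffaceable.exists_zero_mem_representatives {s : Extriangulation E}
    (hF : IsEffaceable s F) {Z : C} {r : FreeAbelianGroup (CoendGen E F Z)}
    (hr : r ∈ coendRelSubgroup E F Z) :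
    ∃ (V : C) (ε : Extn E Z V), (r, 0) ∈ representatives F ε := by
  induction hr using AddSubgroup.closure_induction with
  | mem r hr => exact CoendRel.exists_zero_mem_representatives hF hr
  | zero => exact ⟨Z, 0, zero_mem _⟩
  | add r r' _ _ h h' =>
    obtain ⟨V, ε, h⟩ := h
    obtain ⟨V', ε', h'⟩ := h'
    refine ⟨V ⊞ V', extLift ε ε', ?_⟩
    have h₁ := map_mem_representatives _ (s.push_fst_extLift ε ε') h
    have h₂ := map_mem_representatives _ (s.push_snd_extLift ε ε') h'
    rw [map_zero] at h₁ h₂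
    simpa using add_mem h₁ h₂
  | neg r _ h =>
    obtain ⟨V, ε, h⟩ := h
    exact ⟨V, ε, by simpa using neg_mem h⟩

open Classical in
theorem IsEffaceable.exists_value {s : Extriangulation E} (hF : IsEffaceable s F) {Z V : C}
    (ε : Extn E Z V) : ∃ v : FreeAbelianGroup (CoendGen E F Z) →+ F.obj (op V),
      ∀ (X : C) (x : F.obj (op X)) (f : V ⟶ X), (F.map f.op).hom x -
        v (FreeAbelianGroup.of ⟨X, x, push E f Z ε⟩) ∈ hF.refinedKernel ε := by
  refine ⟨FreeAbelianGroup.lift fun g =>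
    if h : ∃ f : V ⟶ g.1, push E f Z ε = g.2.2 then (F.map h.choose.op).hom g.2.1 else 0,
    fun X x f => ?_⟩
  -- Another choice of `f` changes `f^* x` only by an element that refines to zero.
  have h : ∃ f' : V ⟶ X, push E f' Z ε = push E f Z ε := ⟨f, rfl⟩
  rw [FreeAbelianGroup.lift_apply_of, dif_pos h]
  exact hF.refinesToZero_map_sub_map ε f _ h.choose_spec.symm x

theorem IsEffaceable.refinesToZero_of_zero_mem_representatives {s : Extriangulation E}
    (hF : IsEffaceable s F) {Z V : C} {ε : Extn E Z V} {y : F.obj (op V)}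
    (hy : (0, y) ∈ representatives F ε) : RefinesToZero F ε y := by
  obtain ⟨v, hv⟩ := hF.exists_value ε
  have hle : representatives F ε ≤ (hF.refinedKernel ε).comap
      (AddMonoidHom.snd _ _ - v.comp (AddMonoidHom.fst _ _)) := by
    rw [representatives, AddSubgroup.closure_le]
    rintro _ ⟨X, x, f, rfl⟩
    exact hv X x f
  have hmem : y - v 0 ∈ hF.refinedKernel ε := hle hy
  rwa [map_zero, sub_zero] at hmem

theorem IsEffaceable.refinesToZero_of_tmul_eq_zero {s : Extriangulation E}
    (hF : IsEffaceable s F) {Z W : C} {x : F.obj (op W)} {δ : Extn E Z W} (h : tmul x δ = 0) :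
    RefinesToZero F δ x := by
  obtain ⟨V₀, ε₀, h₀⟩ :=
    hF.exists_zero_mem_representatives ((QuotientAddGroup.eq_zero_iff _).mp h)
  have hzero := map_mem_representatives _ (s.push_fst_extLift ε₀ δ) h₀
  rw [map_zero] at hzero
  have hsnd := of_mem_representatives _ x biprod.snd (s.push_snd_extLift ε₀ δ)
  have hdiff := sub_mem hsnd hzero
  rw [Prod.mk_sub_mk, sub_self, sub_zero] at hdiff
  obtain ⟨V', w, ε', hw, hx⟩ := hF.refinesToZero_of_zero_mem_representatives hdiff
  exact ⟨V', w ≫ biprod.snd, ε', by rw [push_comp, hw, s.push_snd_extLift],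
    by rw [map_comp_apply, hx]⟩

end Effaceable

/-! ### Long exact sequences of higher extensions -/

section ExactSequences

variable {C : Type u} [Category.{v} C] [Preadditive C] [HasBinaryBiproducts C]
  {E : Cᵒᵖ ⥤ C ⥤ AddCommGrpCat.{w}} {F G H : Cᵒᵖ ⥤ AddCommGrpCat.{max u w}}
  {s : Extriangulation E}

theorem KerLeRange.coendTrans (hH : IsEffaceable s H) {φ : F ⟶ G} {ψ : G ⟶ H}
    (h : KerLeRange φ ψ) : KerLeRange (coendTrans (E := E) φ) (coendTrans (E := E) ψ) := by
  intro Z y hy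
  obtain ⟨X, y, δ, rfl⟩ := exists_tmul s y
  rw [coendTrans_app_tmul] at hy
  obtain ⟨V, f, ε, rfl, hf⟩ := hH.refinesToZero_of_tmul_eq_zero hy
  have hψ : (ψ.app (op V)).hom ((G.map f.op).hom y) = 0 := by
    rw [← hf]
    exact ConcreteCategory.congr_hom (ψ.naturality f.op) y
  obtain ⟨x, hx⟩ := h V _ hψ
  exact ⟨tmul x ε, by rw [coendTrans_app_tmul, hx, map_tmul]⟩

variable {A B Z : C} {x : A ⟶ B} {y : B ⟶ Z} {δ : Extn E Z A}

theorem posExt_exact_middle (h : s.Real x y δ) :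
    ∀ i : ℕ, KerLeRange (posExtMap E x i) (posExtMap E y i)
  | 0 => fun Y ε hε => by
    obtain ⟨ε', hε'⟩ := Extriangulation.exists_push_inflation_eq h (ULift.down ε : Extn E Y B)
      (congrArg ULift.down hε)
    exact ⟨ULift.up ε', ULift.ext _ _ hε'⟩
  | i + 1 => (posExt_exact_middle h i).coendTrans (.posExt s Z i)

theorem posExt_exact_right (h : s.Real x y δ) :
    ∀ i : ℕ, KerLeRange (posExtMap E y i) (connecting δ i)
  | 0 => fun Y ε hε => by
    obtain ⟨V, f, ε', hε', hf⟩ := (IsEffaceable.posExt_zero s A).refinesToZero_of_tmul_eq_zero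
      (x := ULift.up δ) (δ := ULift.down ε) hε
    obtain ⟨g, rfl⟩ := Extriangulation.exists_comp_deflation_eq h f (congrArg ULift.down hf)
    exact ⟨ULift.up (push E g Y ε'), ULift.ext _ _ (by rw [← hε', push_comp]; rfl)⟩
  | i + 1 => (posExt_exact_right h i).coendTrans (.posExt s A (i + 1))

theorem posExt_exact_left (h : s.Real x y δ) :
    ∀ i : ℕ, KerLeRange (connecting δ i) (posExtMap E x (i + 1))
  | 0 => fun Y t ht => by
    obtain ⟨W, a, ε, rfl⟩ := exists_tmul s t
    have ht' : tmul (((posExtMap E x 0).app (op W)).hom a) ε = 0 :=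
      (coendTrans_app_tmul _ a ε).symm.trans ht
    obtain ⟨V, f, ε', rfl, hf⟩ :=
      (IsEffaceable.posExt_zero s B).refinesToZero_of_tmul_eq_zero ht'
    have hx : push E x V (pull E f A (ULift.down a)) = 0 := by
      rw [← pull_push]
      exact congrArg ULift.down hf
    obtain ⟨c, hc⟩ := Extriangulation.exists_pull_eq h _ hx
    refine ⟨ULift.up (push E c Y ε'), ?_⟩
    calc tmul (F := posExt E A 0) (ULift.up δ) (push E c Y ε')
        = tmul (((posExt E A 0).map c.op).hom (ULift.up δ)) ε' := (map_tmul c _ ε').symm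
      _ = tmul (((posExt E A 0).map f.op).hom a) ε' :=
          congrArg (fun b => tmul (F := posExt E A 0) b ε') (ULift.ext _ _ hc)
      _ = tmul a (push E f Y ε') := map_tmul f a ε'
  | i + 1 => (posExt_exact_left h i).coendTrans (.posExt s B (i + 1))

namespace Extriangulation

theorem Tri.succExtVanishes_middle (h : s.Tri A B Z) {i : ℕ} {Y : C}
    (hA : SuccExtVanishes E i Y A) (hZ : SuccExtVanishes E i Y Z) : SuccExtVanishes E i Y B := by
  obtain ⟨x, y, δ, h⟩ := h
  exact (posExt_exact_middle h i).subsingleton Y hA hZ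

theorem Tri.succExtVanishes_right (h : s.Tri A B Z) {i : ℕ} {Y : C}
    (hB : SuccExtVanishes E i Y B) (hA : SuccExtVanishes E (i + 1) Y A) :
    SuccExtVanishes E i Y Z := by
  obtain ⟨x, y, δ, h⟩ := h
  exact (posExt_exact_right h i).subsingleton Y hB hA

theorem Tri.succExtVanishes_left (h : s.Tri A B Z) {i : ℕ} {Y : C}
    (hZ : SuccExtVanishes E i Y Z) (hB : SuccExtVanishes E (i + 1) Y B) :
    SuccExtVanishes E (i + 1) Y A := by
  obtain ⟨x, y, δ, h⟩ := h
  exact (posExt_exact_left h i).subsingleton Y hZ hB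

theorem Tri.rightPerp_middle {T : ObjectProperty C} (h : s.Tri A B Z) (hA : rightPerp E T A)
    (hZ : rightPerp E T Z) : rightPerp E T B :=
  fun i Y hY => h.succExtVanishes_middle (hA i Y hY) (hZ i Y hY)

theorem Tri.rightPerp_right {T : ObjectProperty C} (h : s.Tri A B Z) (hA : rightPerp E T A)
    (hB : rightPerp E T B) : rightPerp E T Z :=
  fun i Y hY => h.succExtVanishes_right (hB i Y hY) (hA (i + 1) Y hY)

end Extriangulation

end ExactSequences

/-! ### Resolutions relative to a class of objects -/

section Resolutions

variable {C : Type u} [Category.{v} C] [Preadditive C] [HasBinaryBiproducts C]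
  {E : Cᵒᵖ ⥤ C ⥤ AddCommGrpCat.{w}} {s : Extriangulation E} {X Y ω α T : ObjectProperty C}

namespace Extriangulation

theorem LeftRes.of_le : ∀ {m k : ℕ}, m ≤ k → ∀ {B : C}, s.LeftRes X Y k B → s.LeftRes X Y m B
  | 0, _, _, _, _ => trivial
  | _ + 1, 0, hmk, _, _ => absurd hmk (Nat.not_succ_le_zero _)
  | _ + 1, _ + 1, hmk, _, ⟨K, Y₁, h, hY, hK, hr⟩ =>
    ⟨K, Y₁, h, hY, hK, hr.of_le (Nat.le_of_succ_le_succ hmk)⟩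

theorem LeftRes.mono {X' Y' : ObjectProperty C} (hX : X ≤ X') (hY : Y ≤ Y') :
    ∀ {m : ℕ} {B : C}, s.LeftRes X Y m B → s.LeftRes X' Y' m B
  | 0, _, _ => trivial
  | _ + 1, _, ⟨K, Y₁, h, hY₁, hK, hr⟩ =>
    ⟨K, Y₁, h, hY _ hY₁, hX _ hK, LeftRes.mono hX hY hr⟩

theorem leftRes_of_mem {O : C} (hO : IsZero O) (hXO : X O) (hYO : Y O) {M : C} (hM : Y M) :
    ∀ m : ℕ, s.LeftRes X Y m M
  | 0 => trivial
  | m + 1 =>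
    ⟨O, M, ⟨_, _, _, s.real_zero_of_isZero hO M⟩, hM, hXO, leftRes_of_mem hO hXO hYO hYO m⟩

theorem LeftRes.of_tri (hY : s.ClosedUnderExtensions Y) {L M K : C} (h : s.Tri L M K)
    (hL : Y L) : ∀ {m : ℕ}, s.LeftRes X Y m K → s.LeftRes X Y m M
  | 0, _ => trivial
  | _ + 1, ⟨K', Y', h', hY', hK', hr⟩ => by
    obtain ⟨N, hLN, hK'N⟩ := exists_tri_pullback h h'
    exact ⟨K', N, hK'N, hY _ _ _ hLN hL hY', hK', hr⟩

theorem IsRelGenerator.leftRes (hω : s.IsRelGenerator Y ω) :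
    ∀ (m : ℕ) {M : C}, Y M → s.LeftRes Y ω m M
  | 0, _, _ => trivial
  | m + 1, M, hM => by
    obtain ⟨K, W, h, hW, hK⟩ := hω.2 M hM
    exact ⟨K, W, h, hW, hK, hω.leftRes m hK⟩

theorem IsRelGenerator.leftRes_trans (hω : s.IsRelGenerator Y ω) (hYX : Y ≤ X)
    (hX : s.ClosedUnderExtensions X) (hY : s.ClosedUnderExtensions Y) :
    ∀ {m : ℕ} {B : C}, s.LeftRes X Y m B → s.LeftRes X ω m B
  | 0, _, _ => trivial
  | _ + 1, _, ⟨K, Y₁, h, hY₁, hK, hr⟩ => by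
    obtain ⟨L, W, hLW, hW, hL⟩ := hω.2 Y₁ hY₁
    obtain ⟨M, hMW, hLM⟩ := hLW.comp_deflation h
    exact ⟨M, W, hMW, hW, hX _ _ _ hLM (hYX _ hL) hK,
      hω.leftRes_trans hYX hX hY (hr.of_tri hY hLM hL)⟩

theorem LeftRes.succExtVanishes (hY : Y ≤ rightPerp E T) {n : ℕ}
    (hn : ∀ A : C, X A → ∀ i : ℕ, n ≤ i → ∀ Z : C, T Z → SuccExtVanishes E i Z A) :
    ∀ {m : ℕ} {B : C}, X B → s.LeftRes X Y m B → ∀ i : ℕ, n ≤ i + m → ∀ Z : C, T Z →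
      SuccExtVanishes E i Z B
  | 0, B, hB, _ => hn B hB
  | _ + 1, _, _, ⟨_, Y₁, h, hY₁, hK, hr⟩ => fun i hi Z hZ =>
    h.succExtVanishes_right (hY Y₁ hY₁ i Z hZ)
      (hr.succExtVanishes hY hn hK (i + 1) (by lia) Z hZ)

/-- `N` is an `m`-th cosyzygy of `A`: there are `𝔼`-triangles `N₀ ⟶ I₀ ⟶ N₁`, …,
`Nₘ₋₁ ⟶ Iₘ₋₁ ⟶ Nₘ` with `N₀ = A`, `Nₘ = N`, all `Iⱼ ∈ α`, and `Nⱼ ∈ 𝒳` for `1 ≤ j ≤ m`. -/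
inductive IsCosyzygy (s : Extriangulation E) (X α : ObjectProperty C) (A : C) : ℕ → C → Prop
  | zero : IsCosyzygy s X α A 0 A
  | succ {m : ℕ} {N I N' : C} (hN : IsCosyzygy s X α A m N) (h : s.Tri N I N') (hI : α I)
      (hN' : X N') : IsCosyzygy s X α A (m + 1) N'

theorem IsRelCogenerator.exists_isCosyzygy (hα : s.IsRelCogenerator X α) {A : C} (hA : X A) :
    ∀ m : ℕ, ∃ N : C, s.IsCosyzygy X α A m N ∧ X N
  | 0 => ⟨A, .zero, hA⟩
  | m + 1 => by
    obtain ⟨N, hN, hXN⟩ := hα.exists_isCosyzygy hA m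
    obtain ⟨I, N', h, hI, hN'⟩ := hα.2 N hXN
    exact ⟨N', hN.succ h hI hN', hN'⟩

theorem IsCosyzygy.mem {A N : C} {m : ℕ} (h : s.IsCosyzygy X α A m N) (hA : X A) : X N := by
  cases h with
  | zero => exact hA
  | succ _ _ _ hN' => exact hN'

theorem IsCosyzygy.leftRes {A N : C} {m : ℕ} (h : s.IsCosyzygy X α A m N) (hA : X A) :
    s.LeftRes X α m N := by
  induction h with
  | zero => trivial
  | succ hN h hI _ ih => exact ⟨_, _, h, hI, hN.mem hA, ih⟩

theorem IsCosyzygy.succExtVanishes {Z : C} (hα : ∀ I : C, α I → ∀ i, SuccExtVanishes E i Z I)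
    {A N : C} {m : ℕ} (h : s.IsCosyzygy X α A m N) :
    ∀ {i : ℕ}, SuccExtVanishes E i Z N → SuccExtVanishes E (i + m) Z A := by
  induction h with
  | zero => exact id
  | @succ m N I N' _ h hI _ ih =>
    intro i hi
    rw [← Nat.add_assoc, Nat.add_right_comm]
    exact ih (h.succExtVanishes_left hi (hα I hI (i + 1)))

theorem ClosedByQuotients.mem_of_isCosyzygy {n : ℕ} (hY : s.ClosedByQuotients n X Y)
    (hα : α ≤ Y) {A N : C} (hA : X A) (hN : s.IsCosyzygy X α A n N) : Y N :=
  hY.2 N (hN.mem hA) ((hN.leftRes hA).mono le_rfl hα)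

theorem leftRes_finCores_of_tri (hYX : Y ≤ X) (hX : s.ClosedUnderExtensions X)
    (hY : s.ClosedUnderExtensions Y) (hT : s.IsRelGenerator Y (T ⊓ X)) {N I N' : C}
    (h : s.Tri N I N') (hN : X N) (hI : Y I)
    (hN' : s.LeftRes Y (s.FinCores X T ⊓ X) 1 N') : s.LeftRes Y (s.FinCores X T ⊓ X) 1 N := by
  obtain ⟨L, Q, hQ, ⟨hQT, hQX⟩, hL, -⟩ := hN'
  obtain ⟨U, hNUQ, hLUI⟩ := exists_tri_pullback h hQ
  obtain ⟨K, T₀, hK, hT₀, hKY⟩ := hT.2 U (hY _ _ _ hLUI hL hI)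
  obtain ⟨V, hVTQ, hKVN⟩ := hK.comp_deflation hNUQ
  exact ⟨K, V, hKVN, ⟨.step hVTQ hT₀.1 hQX hQT, hX _ _ _ hKVN (hYX _ hKY) hN⟩, hKY, trivial⟩

theorem IsCosyzygy.leftRes_finCores (hYX : Y ≤ X) (hX : s.ClosedUnderExtensions X)
    (hY : s.ClosedUnderExtensions Y) (hT : s.IsRelGenerator Y (T ⊓ X)) (hα : α ≤ Y) {A N : C}
    {m : ℕ} (h : s.IsCosyzygy X α A m N) (hA : X A)
    (hN : s.LeftRes Y (s.FinCores X T ⊓ X) 1 N) : s.LeftRes Y (s.FinCores X T ⊓ X) 1 A := by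
  induction h with
  | zero => exact hN
  | succ hcos h hI _ ih =>
    exact ih (leftRes_finCores_of_tri hYX hX hY hT h (hcos.mem hA) (hα _ hI) hN)

theorem ClosedByQuotients.t3 {n : ℕ} (hY : s.ClosedByQuotients n X Y)
    (hXext : s.ClosedUnderExtensions X) (hYext : s.ClosedUnderExtensions Y)
    (hT : s.IsRelGenerator Y (T ⊓ X)) (hα : s.IsRelCogenerator X α) (hαY : α ≤ Y) :
    s.T3 X T := by
  refine ⟨s.FinCores X T ⊓ X, inf_le_left, inf_le_right, fun A hA => ?_⟩
  obtain ⟨N, hN, -⟩ := hα.exists_isCosyzygy hA n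
  have hcover : s.LeftRes Y (s.FinCores X T ⊓ X) 1 N :=
    (hT.leftRes 1 (hY.mem_of_isCosyzygy hαY hA hN)).mono le_rfl
      fun _ hT₀ => ⟨.base (Iso.refl _) hT₀.2 hT₀.1, hT₀.2⟩
  obtain ⟨L, Q, hQ, hQT, hL, -⟩ := hN.leftRes_finCores hY.1 hXext hYext hT hαY hA hcover
  exact ⟨L, Q, hQ, hQT, hY.1 L hL⟩

end Extriangulation

end Resolutions

section ProjectiveDimension

variable {C : Type u} [Category.{v} C] {E : Cᵒᵖ ⥤ C ⥤ AddCommGrpCat.{w}}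
  {X T : ObjectProperty C} {n : ℕ}

theorem pd_le_iff : pd E X T ≤ n ↔
    ∀ A : C, X A → ∀ i : ℕ, n ≤ i → ∀ Z : C, T Z → SuccExtVanishes E i Z A := by
  refine iSup₂_le_iff.trans ⟨fun h A hA i hi Z hZ => ?_, fun h Z hZ => ?_⟩
  · have hlt : pdObj E X Z < (n + 1 : ℕ) :=
      (h Z hZ).trans_lt (Nat.cast_lt.mpr n.lt_succ_self)
    simp only [pdObj, iInf_lt_iff] at hlt
    obtain ⟨m, hm, hmn⟩ := hlt
    exact hm i ((Nat.cast_lt.mp hmn).trans_le (Nat.succ_le_succ hi)) A hA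
  · exact iInf₂_le n fun i hi A hA => h A hA i (Nat.lt_succ_iff.mp hi) Z hZ

end ProjectiveDimension

/-! ### The class `𝒯^⊥ ∩ 𝒳` -/

section Tilting

variable {C : Type u} [Category.{v} C] [Preadditive C] [HasBinaryBiproducts C]
  {E : Cᵒᵖ ⥤ C ⥤ AddCommGrpCat.{w}} {s : Extriangulation E} {X T : ObjectProperty C} {n : ℕ}

namespace Extriangulation

theorem ClosedUnderExtensions.rightPerp_inf (hX : s.ClosedUnderExtensions X) :
    s.ClosedUnderExtensions (rightPerp E T ⊓ X) :=
  fun _ _ _ h hA hZ => ⟨h.rightPerp_middle hA.1 hZ.1, hX _ _ _ h hA.2 hZ.2⟩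

theorem biprod_mem_of_precover [T.IsStableUnderRetracts] {M N T' : C} {f : T' ⟶ M ⊞ N}
    (hf : IsPrecover T f) (hM : T M) (hN : T N) : T (M ⊞ N) := by
  obtain ⟨a, ha⟩ := hf.2 M hM biprod.inl
  obtain ⟨b, hb⟩ := hf.2 N hN biprod.inr
  exact T.prop_of_retract ⟨biprod.desc a b, f, by ext <;> simp [ha, hb]⟩ hf.1

theorem biprod_mem (hX : s.ClosedUnderExtensions X) [T.IsStableUnderRetracts] (hT5 : T5 E X T)
    (hTX : T ⊓ X ≤ rightPerp E T) {M N : C} (hM : (T ⊓ X) M) (hN : (T ⊓ X) N) :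
    (T ⊓ X) (M ⊞ N) := by
  have hMN := hX.rightPerp_inf (T := T) _ _ _ (s.tri_biprod M N) ⟨hTX M hM, hM.2⟩ ⟨hTX N hN, hN.2⟩
  obtain ⟨T', f, hf, -⟩ := hT5 (M ⊞ N) hMN.2 hMN.1
  exact ⟨biprod_mem_of_precover hf hM.1 hN.1, hMN.2⟩

theorem rightPerp_of_lift {K T₁ M : C} {k : K ⟶ T₁} {f : T₁ ⟶ M} {δ : Extn E M K}
    (h : s.Real k f δ) (hf : ∀ Z : C, T Z → ∀ g : Z ⟶ M, ∃ g' : Z ⟶ T₁, g' ≫ f = g)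
    (hT₁ : rightPerp E T T₁) (hM : rightPerp E T M) : rightPerp E T K
  | 0, Z, hZ => by
    rw [succExtVanishes_zero_iff]
    refine subsingleton_of_forall_eq 0 fun ε => ?_
    have := succExtVanishes_zero_iff.mp (hT₁ 0 Z hZ)
    obtain ⟨c, rfl⟩ := exists_pull_eq h ε (Subsingleton.elim _ _)
    obtain ⟨c, rfl⟩ := hf Z hZ c
    rw [pull_comp, pull_deflation h, map_zero]
  | i + 1, Z, hZ => Tri.succExtVanishes_left ⟨_, _, _, h⟩ (hM i Z hZ) (hT₁ (i + 1) Z hZ)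

theorem isRelGenerator_rightPerp_inf [HasZeroObject C] (hX : s.ClosedUnderExtensions X)
    [T.IsStableUnderRetracts] (hT5 : T5 E X T) (hTX : T ⊓ X ≤ rightPerp E T)
    (hfac : rightPerp E T ⊓ X ≤ s.Fac X T 1) :
    s.IsRelGenerator (rightPerp E T ⊓ X) (T ⊓ X) := by
  refine ⟨le_inf hTX inf_le_right, fun M hM => ?_⟩
  obtain ⟨L, T₀, ⟨l, g, δ, h⟩, hT₀, hL, -⟩ := hfac M hM
  obtain ⟨T', f, ⟨hT', hf⟩, hXT'⟩ := hT5 M hM.2 hM.1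
  -- The deflation `(f, g) : T' ⊞ T₀ ⟶ M` is still a `𝒯`-precover.
  obtain ⟨K, k, ε, hk, hK⟩ := exists_real_desc h f
  have hmem := biprod_mem hX hT5 hTX ⟨hT', hXT'⟩ hT₀
  have hlift (Z : C) (hZ : T Z) (g' : Z ⟶ M) : ∃ q, q ≫ biprod.desc f g = g' := by
    obtain ⟨q, hq⟩ := hf Z hZ g'
    exact ⟨q ≫ biprod.inl, by simp [hq]⟩
  exact ⟨K, T' ⊞ T₀, ⟨_, _, _, hk⟩, hmem,
    rightPerp_of_lift hk hlift (hTX _ hmem) hM.1, hX _ _ _ hK hL hXT'⟩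

theorem IsRelGenerator.rightPerp_inf_eq_fac
    (h : s.IsRelGenerator (rightPerp E T ⊓ X) (T ⊓ X)) (hfac : s.Fac X T n ⊓ X ≤ rightPerp E T)
    {k : ℕ} (hk : n ≤ k) : rightPerp E T ⊓ X = s.Fac X T k ⊓ X :=
  le_antisymm (fun _ hM => ⟨(h.leftRes k hM).mono inf_le_right le_rfl, hM.2⟩)
    fun _ hM => ⟨hfac _ ⟨hM.1.of_le hk, hM.2⟩, hM.2⟩

theorem IsRelGenerator.closedByQuotients (h : s.IsRelGenerator (rightPerp E T ⊓ X) (T ⊓ X))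
    (hX : s.ClosedUnderExtensions X) (hfac : s.Fac X T n ⊓ X ≤ rightPerp E T) :
    s.ClosedByQuotients n X (rightPerp E T ⊓ X) :=
  ⟨inf_le_right, fun B hB hr =>
    ⟨hfac B ⟨h.leftRes_trans inf_le_right hX hX.rightPerp_inf hr, hB⟩, hB⟩⟩

theorem inf_le_fac {O : C} (hO : IsZero O) (hX : ∀ A : C, X A → X O) [T.IsStableUnderRetracts]
    (m : ℕ) : T ⊓ X ≤ s.Fac X T m := fun M hM =>
  have hTO : T O := T.prop_of_retract (hO.retract M) hM.1
  leftRes_of_mem hO (hX M hM.2) ⟨hTO, hX M hM.2⟩ hM m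

theorem extn_subsingleton_of_finCores (hT4 : s.T4 X T) [T.IsClosedUnderIsomorphisms] {N : C}
    (hN : s.FinCores X T N) (hXN : X N) :
    ∀ {M : C}, (rightPerp E T ⊓ X) M → Subsingleton (Extn E N M) := by
  obtain ⟨α, hα, -, hcogen⟩ := hT4
  induction hN with
  | base e _ hTY =>
    exact fun hM => succExtVanishes_zero_iff.mp (hM.1 0 _ (T.prop_of_iso e.symm hTY))
  | @step N Y N' h hTY hXN' _ ih =>
    intro M hM
    obtain ⟨I, M', hI, hαI, hXM'⟩ := hcogen M hM.2
    have hM' : rightPerp E T M' := hI.rightPerp_right hM.1 (hα I hαI).2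
    exact extn_subsingleton_of_tri h hI (succExtVanishes_zero_iff.mp ((hα I hαI).1 0 N hXN))
      (ih hXN' ⟨hM', hXM'⟩) (succExtVanishes_zero_iff.mp (hM.1 0 Y hTY))

theorem IsTilting.rightPerp_inf_le_fac_one [T.IsClosedUnderIsomorphisms]
    (h : s.IsTilting n X T) (hX : s.ClosedUnderExtensions X) :
    rightPerp E T ⊓ X ≤ s.Fac X T 1 := by
  intro M hM
  obtain ⟨ω, hω, hωX, hgen⟩ := h.t3
  obtain ⟨A, W, hA, hW, hXA⟩ := hgen M hM.2
  cases hω W hW with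
  | base e _ hTY => exact ⟨A, W, hA, ⟨T.prop_of_iso e.symm hTY, hωX W hW⟩, hXA, trivial⟩
  | @step _ Y N hN hTY hXN hcores =>
    obtain ⟨L, hLYM, hALN⟩ :=
      exists_tri_of_extn_subsingleton hA hN (extn_subsingleton_of_finCores h.t4 hcores hXN hM)
    exact ⟨L, Y, hLYM, ⟨hTY, hX _ _ _ hN (hωX W hW) hXN⟩, hX _ _ _ hALN hXA hXN, trivial⟩

theorem IsTilting.fac_inf_le_rightPerp (h : s.IsTilting n X T) :
    s.Fac X T n ⊓ X ≤ rightPerp E T := fun _ hM i Z hZ =>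
  LeftRes.succExtVanishes h.t2 (pd_le_iff.mp h.t1) hM.2 hM.1 i (Nat.le_add_left n i) Z hZ

theorem ClosedByQuotients.isTilting (hq : s.ClosedByQuotients n X (rightPerp E T ⊓ X))
    (hX : s.ClosedUnderExtensions X) (hT : T = T.retractClosure) (hT4 : s.T4 X T)
    (hT5 : T5 E X T) (hgen : s.IsRelGenerator (rightPerp E T ⊓ X) (T ⊓ X)) :
    s.IsTilting n X T := by
  obtain ⟨α, hα, hcogen⟩ := id hT4
  have hαP : α ≤ rightPerp E T ⊓ X := le_inf (hα.trans inf_le_right) hcogen.1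
  refine ⟨hT, pd_le_iff.mpr fun A hA i hi Z hZ => ?_, hgen.1.trans inf_le_left,
    hq.t3 hX hX.rightPerp_inf hgen hcogen hαP, hT4, hT5⟩
  obtain ⟨N, hN, -⟩ := hcogen.exists_isCosyzygy hA n
  obtain ⟨j, rfl⟩ := Nat.exists_eq_add_of_le' hi
  exact hN.succExtVanishes (fun I hI k => (hα I hI).2 k Z hZ)
    ((hq.mem_of_isCosyzygy hαP hA hN).1 j Z hZ)

end Extriangulation

end Tilting

end Extri

theorem theorem3p19_general {C : Type u} [Category.{v} C] [Preadditive C] [HasZeroObject C]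
    [HasBinaryBiproducts C] (E : Cᵒᵖ ⥤ C ⥤ AddCommGrpCat.{w}) (s : Extri.Extriangulation E)
    (n : ℕ) (hn : 1 ≤ n) (X T : ObjectProperty C)
    (hX : ∀ ⦃A O : C⦄, X A → IsZero O → X O) (hXext : s.ClosedUnderExtensions X)
    (hT : T = T.retractClosure) (hT4 : s.T4 X T) (hT5 : Extri.T5 E X T) :
    List.TFAE [
      s.IsTilting n X T,
      s.Fac X T n ⊓ X = Extri.rightPerp E T ⊓ X,
      ∀ k : ℕ, n ≤ k → Extri.rightPerp E T ⊓ X = s.Fac X T k ⊓ X,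
      s.ClosedByQuotients n X (Extri.rightPerp E T ⊓ X) ∧
        T ⊓ X ≤ Extri.rightPerp E T ⊓ X ∧
        Extri.rightPerp E T ⊓ X ≤ s.Fac X T 1] := by
  have : T.IsStableUnderRetracts := by rw [hT]; infer_instance
  have relGen := Extri.Extriangulation.isRelGenerator_rightPerp_inf hXext hT5
  tfae_have 1 → 3 := fun h k hk =>
    (relGen h.t2 (h.rightPerp_inf_le_fac_one hXext)).rightPerp_inf_eq_fac
      h.fac_inf_le_rightPerp hk
  tfae_have 3 → 2 := fun h => (h n le_rfl).symm
  tfae_have 2 → 4 := fun h => by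
    have hle : T ⊓ X ≤ Extri.rightPerp E T ⊓ X := h ▸ le_inf
      (Extri.Extriangulation.inf_le_fac (isZero_zero C) (fun _ hA => hX hA (isZero_zero C)) n)
      inf_le_right
    have hfac : Extri.rightPerp E T ⊓ X ≤ s.Fac X T 1 := fun M hM => (h.ge M hM).1.of_le hn
    exact ⟨(relGen (hle.trans inf_le_left) hfac).closedByQuotients hXext (h.le.trans inf_le_left),
      hle, hfac⟩
  tfae_have 4 → 1 := fun ⟨hq, hle, hfac⟩ =>
    hq.isTilting hXext hT hT4 hT5 (relGen (hle.trans inf_le_left) hfac)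
  tfae_finish

theorem theorem3p19 {C : Type u} [Category.{v} C] [Preadditive C] [HasZeroObject C]
    [HasBinaryBiproducts C] (E : Cᵒᵖ ⥤ C ⥤ AddCommGrpCat.{w}) (s : Extri.Extriangulation E)
    (n : ℕ) (hn : 1 ≤ n) (X T : ObjectProperty C)
    (hX : X = X.retractClosure) (hXext : s.ClosedUnderExtensions X)
    (hT : T = T.retractClosure) (hT4 : s.T4 X T) (hT5 : Extri.T5 E X T) :
    List.TFAE [
      s.IsTilting n X T,
      s.Fac X T n ⊓ X = Extri.rightPerp E T ⊓ X,
      ∀ k : ℕ, n ≤ k → Extri.rightPerp E T ⊓ X = s.Fac X T k ⊓ X,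
      s.ClosedByQuotients n X (Extri.rightPerp E T ⊓ X) ∧
        T ⊓ X ≤ Extri.rightPerp E T ⊓ X ∧
        Extri.rightPerp E T ⊓ X ≤ s.Fac X T 1] := by
  exact theorem3p19_general E s n hn X T
    (fun A _ hA hO => hX ▸ ⟨A, hA, ⟨hO.retract A⟩⟩) hXext hT hT4 hT5
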